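/- Let $m,u\ge 1$ be integers, $n=m+u$, let $z_1,\dots,z_n\in\mathcal X\times\mathcal Y$ be a full sample, and let $\mathcal H$ be a non-empty class of functions $h:\mathcal X\times\mathcal Y\to\mathbb R$; write $h(i)=h(z_i)$, $\mathcal L_n(h)=\frac1n\sum_{i=1}^n h(i)$, $T_n(h)=\frac1n\sum_{i=1}^n h(i)^2$. Let $\mathbf d=(d_1,\dots,d_u)$ have independent coordinates, $d_i$ uniform on $\{i,\dots,n\}$, and let $\mathbf Z_{\mathbf d}=(\mathbf Z_{\mathbf d}(1),\dots,\mathbf Z_{\mathbf d}(u))$ be the output of the algorithm RANDPERM: start with the array $\mathbf I=(1,\dots,n)$ and, for $i=1,\dots,u$, put $\mathbf Z_{\mathbf d}(i)=\mathbf I(d_i)$ and then swap the values $\mathbf I(i)$ and $\mathbf I(d_i)$. (Thus the set $\{\mathbf Z_{\mathbf d}\}$ of test indices is a uniformly random $u$-element subset of $\{1,\dots,n\}$; its complement $\overline{\mathbf Z_{\mathbf d}}$ is the set of the $m$ training indices.) Put $$\mathcal U_h^{(u)}(\mathbf Z_{\mathbf d})=\frac1u\sum_{i\in\{\mathbf Z_{\mathbf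 d}\}}h(i),\qquad \mathcal L_h^{(m)}(\overline{\mathbf Z_{\mathbf d}})=\frac1m\sum_{i\in\overline{\mathbf Z_{\mathbf d}}}h(i),\qquad g_u(\mathbf d)=\sup_{h\in\mathcal H}\mathcal U_h^{(u)}(\mathbf Z_{\mathbf d}).$$ For a class $\mathcal H'$ of functions define the transductive complexities $$\mathfrak R_u^+(\mathcal H')=\mathbb E_{\mathbf d}\Big[\sup_{h\in\mathcal H'}\big(\mathcal U_h^{(u)}(\mathbf Z_{\mathbf d})-\mathcal L_n(h)\big)\Big],\qquad \mathfrak R_m^+(\mathcal H')=\mathbb E_{\mathbf d}\Big[\sup_{h\in\mathcal H'}\big(\mathcal L_h^{(m)}(\overline{\mathbf Z_{\mathbf d}})-\mathcal L_n(h)\big)\Big],$$ and let $\mathfrak R^+_{\min\{u,m\}}$ be $\mathfrak R_u^+$ if $u\le m$ and $\mathfrak R_m^+$ otherwise (for $u=m$ the two coincide). Let $\mathcal H_1=\{h^2: h\in\mathcal H\}$. Suppose that $H_0\ge 2\sqrt2$ and that for all $h\in\mathcal H$: $\mathcal L_n(h)=0$, $|h(i)|\le H_0$ for all $i\in\{1,\dots,n\}$,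 and $T_n(h)\le r$. Then for every $x>0$, with probability at least $1-e^{-x}$ over $\mathbf d$, $$g_u(\mathbf d)-\mathbb E_{\mathbf d}[g_u(\mathbf d)]\le\frac{4m}{n}\left(2\sqrt{\frac{3rx}{\min\{u,m\}}}+\inf_{\alpha>0}\left(\frac{\mathfrak R^+_{\min\{u,m\}}(\mathcal H_1)}{\alpha}+\frac{\alpha x}{\min\{u,m\}}\right)+\frac{2H_0^2x}{\min\{u,m\}}\right).$$ -/

import Mathlib

open MeasureTheory ProbabilityTheory

noncomputable section

namespace Transductive

/-- The vectors `d = (d_1, …, d_u)` with `d_i ∈ [i : n]`, where `n = m + u`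
(positions are numbered from `0`). -/
abbrev Draws (m u : ℕ) : Type :=
  (i : Fin u) → {k : Fin (m + u) // Fin.castLE (Nat.le_add_left u m) i ≤ k}

/-- The law of `d`: the coordinates are independent and `d_i` is uniform on `[i : n]`. -/
def drawLaw (m u : ℕ) : Measure (Draws m u) :=
  Measure.pi fun _ => uniformOn Set.univ

instance instIsProbabilityMeasureDrawLaw (m u : ℕ) : IsProbabilityMeasure (drawLaw m u) := by
  have h : ∀ i : Fin u, IsProbabilityMeasure
      (uniformOn (Set.univ : Set {k : Fin (m + u) //
        Fin.castLE (Nat.le_add_left u m) i ≤ k})) := fun i =>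
    isProbabilityMeasure_uniformOn Set.finite_univ ⟨⟨_, le_refl _⟩, Set.mem_univ _⟩
  unfold drawLaw
  infer_instance

/-- The array `I` of RANDPERM after `k` rounds: it starts as `I = [n]`, and in the round `i` the
values `I(i)` and `I(d_i)` are swapped. -/
def randPermArray {m u : ℕ} (d : Draws m u) : ℕ → Equiv.Perm (Fin (m + u))
  | 0 => 1
  | k + 1 =>
    if hk : k < u then
      randPermArray d k * Equiv.swap (Fin.castLE (Nat.le_add_left u m) ⟨k, hk⟩) (d ⟨k, hk⟩).1
    else randPermArray d k

/-- The output `Z_d` of RANDPERM: `Z_d(i) = I(d_i)`, read off just before the swap of round `i`. -/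
def randPerm {m u : ℕ} (d : Draws m u) (i : Fin u) : Fin (m + u) :=
  randPermArray d i (d i).1

/-- The set `{Z_d}` of indices of the test points. -/
def testIdx {m u : ℕ} (d : Draws m u) : Finset (Fin (m + u)) :=
  Finset.univ.image (randPerm d)

/-- The set of indices of the training points, the complement of `{Z_d}`. -/
def trainIdx {m u : ℕ} (d : Draws m u) : Finset (Fin (m + u)) :=
  (testIdx d)ᶜ

/-- `L_n(h) = (1/n) ∑ h(i)`, where `h(i)` is the value of `h` at the `i`-th sample point `z i`. -/
def fullAvg {S : Type*} {m u : ℕ} (z : Fin (m + u) → S) (h : S → ℝ) : ℝ :=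
  (1 / ((m + u : ℕ) : ℝ)) * ∑ i, h (z i)

/-- `T_n(h) = (1/n) ∑ h(i)²`. -/
def fullSqAvg {S : Type*} {m u : ℕ} (z : Fin (m + u) → S) (h : S → ℝ) : ℝ :=
  (1 / ((m + u : ℕ) : ℝ)) * ∑ i, h (z i) ^ 2

/-- The test average `U_h^{(u)}(Z_d)`. -/
def testAvg {S : Type*} {m u : ℕ} (z : Fin (m + u) → S) (d : Draws m u) (h : S → ℝ) : ℝ :=
  (1 / (u : ℝ)) * ∑ i ∈ testIdx d, h (z i)

/-- The training average `L_h^{(m)}` over the complement of `{Z_d}`. -/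
def trainAvg {S : Type*} {m u : ℕ} (z : Fin (m + u) → S) (d : Draws m u) (h : S → ℝ) : ℝ :=
  (1 / (m : ℝ)) * ∑ i ∈ trainIdx d, h (z i)

/-- The supremum `g_u(d)` of the test averages over the class `H`. -/
def supTest {S : Type*} {m u : ℕ} (z : Fin (m + u) → S) (H : Set (S → ℝ)) (d : Draws m u) : ℝ :=
  ⨆ h : H, testAvg z d h.1

/-- The transductive complexity `R_u^+(H)`. -/
def testComplexity {S : Type*} {m u : ℕ} (z : Fin (m + u) → S) (H : Set (S → ℝ)) : ℝ :=
  ∫ d : Draws m u, (⨆ h : H, (testAvg z d h.1 - fullAvg z h.1)) ∂(drawLaw m u)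

/-- The transductive complexity `R_m^+(H)`. -/
def trainComplexity {S : Type*} {m u : ℕ} (z : Fin (m + u) → S) (H : Set (S → ℝ)) : ℝ :=
  ∫ d : Draws m u, (⨆ h : H, (trainAvg z d h.1 - fullAvg z h.1)) ∂(drawLaw m u)

/-- The transductive complexity `R_{min(u,m)}^+(H)`. For `u = m` the two complexities agree, since
test set and training set then have the same law. -/
def minComplexity {S : Type*} {m u : ℕ} (z : Fin (m + u) → S) (H : Set (S → ℝ)) : ℝ :=
  if u ≤ m then testComplexity z H else trainComplexity z H

/-- The class `H_1 = {h² : h ∈ H}`. -/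
def squareClass {S : Type*} (H : Set (S → ℝ)) : Set (S → ℝ) :=
  {f | ∃ h ∈ H, f = fun p => h p ^ 2}

end Transductive

end

noncomputable section

namespace Transductive

open Finset
open scoped BigOperators

/-! The test set is a uniform `u`-subset of the sample, so this is concentration on a slice of the
cube, obtained by the entropy method. Let `k` be the smaller of `u`, `m` and `K` the larger. For `u
≤ m` the test set is treated directly; for `m < u` the condition that each `h` averages to zero
turns the test average into `m / u` times the training average of `-h`, and `-h` has the same
squares.

The modified logarithmic Sobolev inequality `finEnt_powersetCard_le` bounds the entropy of `exp (t *
Z)` by `t ^ 2` times the mean of `exp (t * Z) * upVar`. For the supremum `G` of averages, `upVar` is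
at most `(2 / k) * (Q + r) + 4 * r / k`, where `Q` is the supremum of the centred averages of
squares. Replacing this random bound by its mean is the heart of the matter: `Q + r` is
self-bounding, its own `upVar` being at most `H₀ ^ 2 / k` times itself, so its exponential moments
are controlled, and the entropy inequality decouples it from `exp (t * G)`
(`finEnt_le_of_decoupling`).

The Herbst argument then gives a sub-gamma bound with variance factor `v = (2 * R + 6 * r) / k`,
where `R` is the mean of `Q`, that is, the complexity of the class of squares. Chernoff's bound and
AM-GM give the stated form. -/

/-- The entropy `E[f log f] - E[f] log E[f]` of `f` under the uniform law on `s`. -/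
def finEnt {ι : Type*} (s : Finset ι) (f : ι → ℝ) : ℝ :=
  𝔼 i ∈ s, f i * Real.log (f i) - (𝔼 i ∈ s, f i) * Real.log (𝔼 i ∈ s, f i)

/-- The symmetrized divergence `(x - y) (log x - log y)`. -/
def symDiv (x y : ℝ) : ℝ := (x - y) * (Real.log x - Real.log y)

theorem symDiv_self (x : ℝ) : symDiv x x = 0 := by simp [symDiv]

theorem symDiv_comm (x y : ℝ) : symDiv x y = symDiv y x := by unfold symDiv; ring

/-! ### Entropy and symmetrized divergence on a finite uniform space. -/

section Entropy

variable {ι : Type*} {s : Finset ι}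

theorem log_sub_log_lower {x y X Y : ℝ} (hx : 0 < x) (hy : 0 < y) (hX : 0 < X) (hY : 0 < Y) :
    x - y * (X / Y) ≤ x * (Real.log x - Real.log y) - x * (Real.log X - Real.log Y) := by
  have h := Real.log_le_sub_one_of_pos (show 0 < y * X / (x * Y) by positivity)
  rw [Real.log_div (by positivity) (by positivity), Real.log_mul hy.ne' hX.ne',
    Real.log_mul hx.ne' hY.ne'] at h
  have h2 := mul_le_mul_of_nonneg_left h hx.le
  have h3 : x * (y * X / (x * Y) - 1) = y * (X / Y) - x := by field_simp
  rw [h3] at h2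
  linarith

/-- The log-sum inequality: in the pointwise tangent bound for `log`, the left side averages to `X -
Y * (X / Y) = 0`. -/
theorem expect_log_sum (hs : s.Nonempty) {x y : ι → ℝ} (hx : ∀ i ∈ s, 0 < x i)
    (hy : ∀ i ∈ s, 0 < y i) :
    (𝔼 i ∈ s, x i) * (Real.log (𝔼 i ∈ s, x i) - Real.log (𝔼 i ∈ s, y i)) ≤
      𝔼 i ∈ s, x i * (Real.log (x i) - Real.log (y i)) := by
  have hX : 0 < 𝔼 i ∈ s, x i := expect_pos hx hs
  have hY : 0 < 𝔼 i ∈ s, y i := expect_pos hy hs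
  set X := 𝔼 i ∈ s, x i with hXd
  set Y := 𝔼 i ∈ s, y i with hYd
  have h := expect_le_expect fun i hi => log_sub_log_lower (hx i hi) (hy i hi) hX hY
  rw [expect_sub_distrib, expect_sub_distrib, ← expect_mul, ← expect_mul, ← hXd, ← hYd,
    mul_div_cancel₀ _ hY.ne'] at h
  linarith

/-- Joint convexity of `symDiv`: add the log-sum inequalities in both orders. -/
theorem symDiv_expect_le (hs : s.Nonempty) {x y : ι → ℝ} (hx : ∀ i ∈ s, 0 < x i)
    (hy : ∀ i ∈ s, 0 < y i) :
    symDiv (𝔼 i ∈ s, x i) (𝔼 i ∈ s, y i) ≤ 𝔼 i ∈ s, symDiv (x i) (y i) := by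
  have h1 := expect_log_sum hs hx hy
  have h2 := expect_log_sum hs hy hx
  have h3 : 𝔼 i ∈ s, symDiv (x i) (y i) =
      𝔼 i ∈ s, x i * (Real.log (x i) - Real.log (y i)) +
        𝔼 i ∈ s, y i * (Real.log (y i) - Real.log (x i)) := by
    rw [← expect_add_distrib]
    exact expect_congr rfl fun i _ => by unfold symDiv; ring
  rw [h3]
  unfold symDiv
  linarith

theorem expect_log_le (hs : s.Nonempty) {x : ι → ℝ} (hx : ∀ i ∈ s, 0 < x i) :
    𝔼 i ∈ s, Real.log (x i) ≤ Real.log (𝔼 i ∈ s, x i) := by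
  have h := expect_log_sum (x := fun _ => (1 : ℝ)) hs (fun _ _ => one_pos) hx
  simp only [expect_const hs, Real.log_one, one_mul, zero_sub, expect_neg_distrib] at h
  linarith

/-- Expanded, the right side is the covariance of `φ` and `log φ`; Jensen's inequality for `log`
makes it dominate the entropy. -/
theorem finEnt_le_expect_symDiv (hs : s.Nonempty) {φ : ι → ℝ} (hφ : ∀ i ∈ s, 0 < φ i) :
    finEnt s φ ≤ (1 / 2) * 𝔼 a ∈ s, 𝔼 b ∈ s, symDiv (φ a) (φ b) := by
  have h1 := mul_le_mul_of_nonneg_left (expect_log_le hs hφ) (expect_pos hφ hs).le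
  have h2 : 𝔼 a ∈ s, 𝔼 b ∈ s, symDiv (φ a) (φ b) =
      2 * (𝔼 i ∈ s, φ i * Real.log (φ i) - (𝔼 i ∈ s, φ i) * 𝔼 i ∈ s, Real.log (φ i)) := by
    have h3 : ∀ a b, symDiv (φ a) (φ b) = φ a * Real.log (φ a) + φ b * Real.log (φ b)
        - φ a * Real.log (φ b) - Real.log (φ a) * φ b := fun a b => by unfold symDiv; ring
    simp only [h3, expect_sub_distrib, expect_add_distrib, expect_const hs, ← mul_expect,
      ← expect_mul]
    ring
  rw [h2]
  unfold finEnt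
  linarith

/-- The entropy inequality (one half of the variational formula for the entropy). -/
theorem expect_exp_mul_le (hs : s.Nonempty) (f W : ι → ℝ) :
    𝔼 i ∈ s, Real.exp (f i) * W i ≤ finEnt s (fun i => Real.exp (f i)) +
      (𝔼 i ∈ s, Real.exp (f i)) * Real.log (𝔼 i ∈ s, Real.exp (W i)) := by
  have h := expect_log_sum (x := fun i => Real.exp (f i)) (y := fun i => Real.exp (W i)) hs
    (fun _ _ => Real.exp_pos _) (fun _ _ => Real.exp_pos _)
  simp only [Real.log_exp, mul_sub, expect_sub_distrib] at h
  unfold finEnt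
  simp only [Real.log_exp]
  linarith

end Entropy

/-! ### The modified logarithmic Sobolev inequality on the slice. -/

section Slice

variable {α : Type*} [DecidableEq α]

/-- The set `S` with the roles of the points `p` and `q` exchanged. -/
def exch (p q : α) (S : Finset α) : Finset α := S.map (Equiv.swap p q).toEmbedding

theorem mem_exch {p q x : α} {S : Finset α} : x ∈ exch p q S ↔ Equiv.swap p q x ∈ S := by
  simp [exch, Finset.mem_map_equiv]

theorem exch_exch (p q : α) (S : Finset α) : exch p q (exch p q S) = S := by
  ext x; simp [mem_exch]

theorem exch_comm (p q : α) (S : Finset α) : exch p q S = exch q p S := by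
  unfold exch; rw [Equiv.swap_comm]

theorem card_exch (p q : α) (S : Finset α) : #(exch p q S) = #S := by simp [exch]

theorem exch_insert_left (p q : α) (S : Finset α) :
    exch p q (insert p S) = insert q (exch p q S) := by
  simp [exch, Finset.map_insert]

theorem exch_insert_of_ne {p q a : α} (hp : a ≠ p) (hq : a ≠ q) (S : Finset α) :
    exch p q (insert a S) = insert a (exch p q S) := by
  simp [exch, Finset.map_insert, Equiv.swap_apply_of_ne_of_ne hp hq]

theorem exch_of_mem {p q : α} {S : Finset α} (hp : p ∈ S) (hq : q ∈ S) : exch p q S = S := by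
  ext x
  rw [mem_exch]
  rcases eq_or_ne x p with rfl | h1
  · simp [hp, hq]
  rcases eq_or_ne x q with rfl | h2
  · simp [hp, hq]
  rw [Equiv.swap_apply_of_ne_of_ne h1 h2]

theorem exch_subset {p q : α} {S A : Finset α} (hp : p ∈ A) (hq : q ∈ A) (hS : S ⊆ A) :
    exch p q S ⊆ A := by
  intro x hx
  have h := hS (mem_exch.1 hx)
  have h2 : x ∈ exch p q A := mem_exch.2 h
  rwa [exch_of_mem hp hq] at h2

theorem sum_exch {p q : α} {S : Finset α} (hp : p ∈ S) (hq : q ∉ S) (h : α → ℝ) :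
    ∑ x ∈ exch p q S, h x = ∑ x ∈ S, h x - h p + h q := by
  unfold exch
  rw [Finset.sum_map, ← Finset.add_sum_erase S h hp, ← Finset.add_sum_erase S _ hp]
  have : ∑ x ∈ S.erase p, h ((Equiv.swap p q).toEmbedding x) = ∑ x ∈ S.erase p, h x := by
    refine Finset.sum_congr rfl fun x hx => ?_
    rw [Equiv.coe_toEmbedding, Equiv.swap_apply_of_ne_of_ne (Finset.ne_of_mem_erase hx)]
    rintro rfl
    exact hq (Finset.mem_of_mem_erase hx)
  rw [this]
  simp
  ring

theorem sum_powersetCard_succ (A : Finset α) (k : ℕ) (F : α → Finset α → ℝ) :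
    ∑ S ∈ A.powersetCard (k + 1), ∑ a ∈ S, F a S =
      ∑ a ∈ A, ∑ T ∈ (A.erase a).powersetCard k, F a (insert a T) := by
  rw [Finset.sum_sigma', Finset.sum_sigma']
  refine Finset.sum_bij' (fun x _ => ⟨x.2, x.1.erase x.2⟩) (fun y _ => ⟨insert y.1 y.2, y.1⟩)
    ?_ ?_ ?_ ?_ ?_
  · rintro ⟨S, a⟩ h
    simp only [mem_sigma, mem_powersetCard] at h ⊢
    obtain ⟨⟨h1, h2⟩, h3⟩ := h
    exact ⟨h1 h3, erase_subset_erase _ h1, by rw [card_erase_of_mem h3, h2]; rfl⟩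
  · rintro ⟨a, T⟩ h
    simp only [mem_sigma, mem_powersetCard] at h ⊢
    obtain ⟨h1, h2, h3⟩ := h
    have h4 : a ∉ T := fun h => by simpa using h2 h
    refine ⟨⟨insert_subset h1 (h2.trans (erase_subset _ _)), ?_⟩, mem_insert_self _ _⟩
    rw [card_insert_of_notMem h4, h3]
  · rintro ⟨S, a⟩ h
    simp only [mem_sigma, mem_powersetCard] at h
    simp [insert_erase h.2]
  · rintro ⟨a, T⟩ h
    simp only [mem_sigma, mem_powersetCard] at h
    have h4 : a ∉ T := fun h' => by simpa using h.2.1 h'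
    simp [erase_insert h4]
  · rintro ⟨S, a⟩ h
    simp only [mem_sigma, mem_powersetCard] at h
    simp [insert_erase h.2]

/-- Marking a uniform point of a uniform `(k + 1)`-set amounts to choosing a uniform `a` and then a
uniform `k`-subset of the rest; the factor `k + 1` counts the possible marks. -/
theorem expect_powersetCard_succ {A : Finset α} {k K : ℕ} (hA : #A = k + 1 + K)
    (F : α → Finset α → ℝ) :
    𝔼 S ∈ A.powersetCard (k + 1), ∑ a ∈ S, F a S =
      (k + 1) * 𝔼 a ∈ A, 𝔼 T ∈ (A.erase a).powersetCard k, F a (insert a T) := by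
  have h1 : ∀ a ∈ A, 𝔼 T ∈ (A.erase a).powersetCard k, F a (insert a T) =
      (∑ T ∈ (A.erase a).powersetCard k, F a (insert a T)) / ((k + K).choose k : ℝ) := by
    intro a ha
    rw [expect_eq_sum_div_card, card_powersetCard, card_erase_of_mem ha, hA]
    congr 3
    omega
  rw [expect_congr rfl h1, expect_eq_sum_div_card, expect_eq_sum_div_card, ← Finset.sum_div,
    sum_powersetCard_succ, card_powersetCard, hA]
  have h2 : ((k + K + 1 : ℕ) : ℝ) * ((k + K).choose k : ℝ) =
      ((k + 1 + K).choose (k + 1) : ℝ) * (k + 1 : ℕ) := by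
    rw [show k + 1 + K = k + K + 1 by omega]
    exact_mod_cast Nat.add_one_mul_choose_eq (k + K) k
  have h3 : ((k + K).choose k : ℝ) ≠ 0 := by
    exact_mod_cast (Nat.choose_pos (by omega)).ne'
  have h4 : ((k + 1 + K).choose (k + 1) : ℝ) ≠ 0 := by
    exact_mod_cast (Nat.choose_pos (by omega)).ne'
  rw [show k + 1 + K = k + K + 1 by omega] at *
  have h5 : ((k + K + 1 : ℕ) : ℝ) ≠ 0 := by positivity
  set B := ∑ a ∈ A, ∑ T ∈ (A.erase a).powersetCard k, F a (insert a T)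
  rw [div_div, mul_comm ((k + K).choose k : ℝ), h2]
  push_cast
  field_simp

theorem expect_powersetCard_succ' {A : Finset α} {k K : ℕ} (hA : #A = k + 1 + K)
    (f : Finset α → ℝ) :
    𝔼 S ∈ A.powersetCard (k + 1), f S =
      𝔼 a ∈ A, 𝔼 T ∈ (A.erase a).powersetCard k, f (insert a T) := by
  have h := expect_powersetCard_succ hA (fun _ S => f S)
  have h2 : 𝔼 S ∈ A.powersetCard (k + 1), ∑ a ∈ S, f S =
      (k + 1) * 𝔼 S ∈ A.powersetCard (k + 1), f S := by
    rw [mul_expect]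
    refine expect_congr rfl fun S hS => ?_
    simp [(mem_powersetCard.1 hS).2]
  rw [h2] at h
  exact mul_left_cancel₀ (by positivity) h

/-- The chain rule for entropy, conditioning on the marked point. -/
theorem finEnt_powersetCard_succ {A : Finset α} {k K : ℕ} (hA : #A = k + 1 + K)
    (f : Finset α → ℝ) :
    finEnt (A.powersetCard (k + 1)) f =
      𝔼 a ∈ A, finEnt ((A.erase a).powersetCard k) (fun T => f (insert a T)) +
        finEnt A (fun a => 𝔼 T ∈ (A.erase a).powersetCard k, f (insert a T)) := by
  unfold finEnt
  rw [expect_powersetCard_succ' hA f, expect_powersetCard_succ' hA, expect_sub_distrib]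
  ring

/-- A coupling: exchanging `a` and `b` carries the uniform law on sets marked at `a` to that on sets
marked at `b`. -/
theorem expect_insert_exch {A : Finset α} {k : ℕ} {a b : α} (ha : a ∈ A) (hb : b ∈ A)
    (f : Finset α → ℝ) :
    𝔼 T ∈ (A.erase b).powersetCard k, f (insert b T) =
      𝔼 T ∈ (A.erase a).powersetCard k, f (exch a b (insert a T)) := by
  have key : ∀ a ∈ A, ∀ b ∈ A, ∀ T ∈ (A.erase a).powersetCard k,
      exch a b T ∈ (A.erase b).powersetCard k := by
    intro a ha b hb T hT
    rw [mem_powersetCard] at hT ⊢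
    refine ⟨fun x hx => mem_erase.2 ⟨?_, ?_⟩, by rw [card_exch, hT.2]⟩
    · rintro rfl
      rw [mem_exch, Equiv.swap_apply_right] at hx
      simpa using hT.1 hx
    · exact exch_subset ha hb (hT.1.trans (erase_subset _ _)) hx
  symm
  refine expect_nbij' (exch a b) (exch a b) (key a ha b hb) ?_ ?_ ?_ ?_
  · intro T hT
    rw [exch_comm]
    exact key b hb a ha T hT
  · exact fun T _ => exch_exch _ _ _
  · exact fun T _ => exch_exch _ _ _
  · exact fun T _ => by rw [exch_insert_left]

theorem symDiv_nonneg {x y : ℝ} (hx : 0 < x) (hy : 0 < y) : 0 ≤ symDiv x y := by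
  unfold symDiv
  rcases le_total x y with h | h
  · exact mul_nonneg_of_nonpos_of_nonpos (by linarith) (by linarith [Real.log_le_log hx h])
  · exact mul_nonneg (by linarith) (by linarith [Real.log_le_log hy h])

/-- The modified logarithmic Sobolev inequality on the slice of `k`-element subsets of `A`. -/
theorem finEnt_powersetCard_le {K : ℕ} (hK : 0 < K) (k : ℕ) :
    ∀ (A : Finset α), #A = k + K → ∀ f : Finset α → ℝ, (∀ S, 0 < f S) →
      finEnt (A.powersetCard k) f ≤ (1 / (2 * K)) * 𝔼 S ∈ A.powersetCard k,
        ∑ p ∈ S, ∑ q ∈ A \ S, symDiv (f S) (f (exch p q S)) := by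
  induction k with
  | zero => intro A hA f hf; simp [finEnt]
  | succ k ih =>
    intro A hA f hf
    have hne : A.Nonempty := card_pos.1 (by omega)
    have hne' : ∀ a ∈ A, ((A.erase a).powersetCard k).Nonempty := fun a ha =>
      powersetCard_nonempty.2 (by rw [card_erase_of_mem ha]; omega)
    set g : Finset α → α → ℝ := fun S p => ∑ q ∈ A \ S, symDiv (f S) (f (exch p q S)) with hg
    set D := 𝔼 S ∈ A.powersetCard (k + 1), ∑ p ∈ S, g S p with hD
    have hD0 : 0 ≤ D := expect_nonneg fun S _ => sum_nonneg fun p _ => sum_nonneg fun q _ =>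
      symDiv_nonneg (hf _) (hf _)
    have h1 : 𝔼 a ∈ A, finEnt ((A.erase a).powersetCard k) (fun T => f (insert a T)) ≤
        (1 / (2 * K)) * ((k / (k + 1)) * D) := by
      have h2 : ∀ a ∈ A, finEnt ((A.erase a).powersetCard k) (fun T => f (insert a T)) ≤
          (1 / (2 * K)) * 𝔼 T ∈ (A.erase a).powersetCard k,
            ∑ p ∈ (insert a T).erase a, g (insert a T) p := by
        intro a ha
        refine (ih (A.erase a) (by rw [card_erase_of_mem ha]; omega) (fun T => f (insert a T))
          fun T => hf _).trans_eq ?_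
        congr 1
        refine expect_congr rfl fun T hT => ?_
        rw [mem_powersetCard] at hT
        have haT : a ∉ T := fun h => by simpa using hT.1 h
        rw [erase_insert haT]
        refine sum_congr rfl fun p hp => ?_
        -- Fixing the marked point leaves the complement alone, so `K` is constant along the
        -- induction.
        have hs : A.erase a \ T = A \ insert a T := by
          ext x; simp only [mem_sdiff, mem_erase, mem_insert]; tauto
        rw [hg, hs]
        refine sum_congr rfl fun q hq => ?_
        rw [exch_insert_of_ne]
        · rintro rfl; exact haT hp
        · rintro rfl; simp at hq
      refine (expect_le_expect h2).trans_eq ?_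
      rw [← mul_expect]
      congr 1
      have h3 := expect_powersetCard_succ hA (fun a S => ∑ p ∈ S.erase a, g S p)
      -- Each `p ∈ S` is counted once for each of the `k` marks other than `p`.
      have h4 : 𝔼 S ∈ A.powersetCard (k + 1), ∑ a ∈ S, ∑ p ∈ S.erase a, g S p = k * D := by
        rw [hD, mul_expect]
        refine expect_congr rfl fun S hS => ?_
        have : ∀ a ∈ S, ∑ p ∈ S.erase a, g S p = ∑ p ∈ S, g S p - g S a := fun a ha => by
          rw [← add_sum_erase S (g S) ha]; ring
        rw [sum_congr rfl this, sum_sub_distrib, sum_const, (mem_powersetCard.1 hS).2, nsmul_eq_mul]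
        push_cast
        ring
      rw [h4] at h3
      rw [div_mul_eq_mul_div, h3]
      field_simp
    have h2 : finEnt A (fun a => 𝔼 T ∈ (A.erase a).powersetCard k, f (insert a T)) ≤
        (1 / 2) * ((1 / (k + 1 + K)) * ((1 / (k + 1)) * D)) := by
      refine (finEnt_le_expect_symDiv hne fun a ha => expect_pos (fun _ _ => hf _)
        (hne' a ha)).trans ?_
      refine mul_le_mul_of_nonneg_left ?_ (by norm_num)
      have h3 : ∀ a ∈ A, 𝔼 b ∈ A, symDiv (𝔼 T ∈ (A.erase a).powersetCard k, f (insert a T))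
          (𝔼 T ∈ (A.erase b).powersetCard k, f (insert b T)) ≤
          (1 / (k + 1 + K)) * 𝔼 T ∈ (A.erase a).powersetCard k, g (insert a T) a := by
        intro a ha
        have h4 : ∀ b ∈ A, symDiv (𝔼 T ∈ (A.erase a).powersetCard k, f (insert a T))
            (𝔼 T ∈ (A.erase b).powersetCard k, f (insert b T)) ≤
            𝔼 T ∈ (A.erase a).powersetCard k,
              symDiv (f (insert a T)) (f (exch a b (insert a T))) := by
          intro b hb
          rw [expect_insert_exch ha hb]
          exact symDiv_expect_le (hne' a ha) (fun _ _ => hf _) (fun _ _ => hf _)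
        refine (expect_le_expect h4).trans_eq ?_
        rw [expect_comm, mul_expect]
        refine expect_congr rfl fun T hT => ?_
        rw [mem_powersetCard] at hT
        have hsub : insert a T ⊆ A := insert_subset ha (hT.1.trans (erase_subset _ _))
        rw [expect_eq_sum_div_card, hA, hg, ← sum_sdiff hsub]
        have : ∑ b ∈ insert a T, symDiv (f (insert a T)) (f (exch a b (insert a T))) = 0 :=
          sum_eq_zero fun b hb => by rw [exch_of_mem (mem_insert_self _ _) hb, symDiv_self]
        rw [this]
        push_cast
        ring
      refine (expect_le_expect h3).trans_eq ?_
      rw [← mul_expect]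
      congr 1
      have h5 := expect_powersetCard_succ hA (fun a S => g S a)
      rw [← hD] at h5
      rw [h5]
      field_simp
    rw [finEnt_powersetCard_succ hA]
    refine (add_le_add h1 h2).trans ?_
    have hK' : (0 : ℝ) < K := by exact_mod_cast hK
    -- After this loss the two parts have weights `k / (k + 1)` and `1 / (k + 1)`, which add up to
    -- one.
    have h6 : 1 / ((k : ℝ) + 1 + K) ≤ 1 / K :=
      one_div_le_one_div_of_le hK' (by linarith [(k.cast_nonneg : (0 : ℝ) ≤ k)])
    have h7 := mul_le_mul_of_nonneg_right h6 (show 0 ≤ (1 / ((k : ℝ) + 1)) * D by positivity)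
    calc _ ≤ 1 / (2 * (K : ℝ)) * (k / (k + 1) * D) + 1 / 2 * (1 / K * (1 / (k + 1) * D)) := by
          linarith
      _ = 1 / (2 * K) * D := by field_simp

/-- Reversibility of the exchange dynamics: `(S, p, q) ↦ (exch p q S, q, p)` is an involution of the
index set. -/
theorem sum_exch_symm (A : Finset α) (k : ℕ) (F : Finset α → Finset α → ℝ) :
    ∑ S ∈ A.powersetCard k, ∑ p ∈ S, ∑ q ∈ A \ S, F (exch p q S) S =
      ∑ S ∈ A.powersetCard k, ∑ p ∈ S, ∑ q ∈ A \ S, F S (exch p q S) := by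
  simp_rw [← Finset.sum_product']
  rw [Finset.sum_sigma', Finset.sum_sigma']
  have key : ∀ x ∈ (A.powersetCard k).sigma (fun S => S ×ˢ (A \ S)),
      (⟨exch x.2.1 x.2.2 x.1, (x.2.2, x.2.1)⟩ : (_ : Finset α) × (α × α)) ∈
        (A.powersetCard k).sigma (fun S => S ×ˢ (A \ S)) := by
    rintro ⟨S, p, q⟩ h
    simp only [mem_sigma, mem_powersetCard, mem_product, mem_sdiff, mem_exch, card_exch,
      Equiv.swap_apply_left, Equiv.swap_apply_right] at h ⊢
    obtain ⟨⟨h1, h2⟩, h3, h4, h5⟩ := h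
    exact ⟨⟨exch_subset (h1 h3) h4 h1, h2⟩, h3, h1 h3, h5⟩
  refine Finset.sum_bij' (fun x _ => ⟨exch x.2.1 x.2.2 x.1, (x.2.2, x.2.1)⟩)
    (fun x _ => ⟨exch x.2.1 x.2.2 x.1, (x.2.2, x.2.1)⟩) key key ?_ ?_ ?_
  · rintro ⟨S, p, q⟩ _
    simp [exch_comm q p, exch_exch]
  · rintro ⟨S, p, q⟩ _
    simp [exch_comm q p, exch_exch]
  · rintro ⟨S, p, q⟩ _
    simp [exch_comm q p, exch_exch]

/-- At most one summand on the right is nonzero; convexity of `exp` gives `exp a - exp b ≤ exp a *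
(a - b)` for `b ≤ a`. -/
theorem symDiv_exp_le (a b : ℝ) :
    symDiv (Real.exp a) (Real.exp b) ≤
      Real.exp a * (max (a - b) 0) ^ 2 + Real.exp b * (max (b - a) 0) ^ 2 := by
  have key : ∀ a b : ℝ, b ≤ a →
      symDiv (Real.exp a) (Real.exp b) ≤ Real.exp a * (max (a - b) 0) ^ 2 := by
    intro a b h
    rw [max_eq_left (by linarith)]
    unfold symDiv
    rw [Real.log_exp, Real.log_exp]
    have h1 : Real.exp b = Real.exp a * Real.exp (b - a) := by rw [← Real.exp_add]; ring_nf
    have h2 := Real.add_one_le_exp (b - a)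
    have h3 : Real.exp a - Real.exp b ≤ Real.exp a * (a - b) := by
      rw [h1]
      nlinarith [Real.exp_pos a]
    nlinarith [mul_le_mul_of_nonneg_right h3 (show 0 ≤ a - b by linarith)]
  rcases le_total b a with h | h
  · have := key a b h
    have h2 : 0 ≤ Real.exp b * (max (b - a) 0) ^ 2 := by positivity
    linarith
  · have := key b a h
    rw [symDiv_comm] at this
    have h2 : 0 ≤ Real.exp a * (max (a - b) 0) ^ 2 := by positivity
    linarith

/-- The upward variation of `Z` at `S`. -/
def upVar (A : Finset α) (K : ℕ) (Z : Finset α → ℝ) (S : Finset α) : ℝ :=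
  (1 / (K : ℝ)) * ∑ p ∈ S, ∑ q ∈ A \ S, (max (Z S - Z (exch p q S)) 0) ^ 2

theorem finEnt_exp_le_upVar {A : Finset α} {k K : ℕ} (hK : 0 < K) (hA : #A = k + K)
    (Z : Finset α → ℝ) {t : ℝ} (ht : 0 ≤ t) :
    finEnt (A.powersetCard k) (fun S => Real.exp (t * Z S)) ≤
      t ^ 2 * 𝔼 S ∈ A.powersetCard k, Real.exp (t * Z S) * upVar A K Z S := by
  refine (finEnt_powersetCard_le hK k A hA _ fun _ => Real.exp_pos _).trans ?_
  set F : Finset α → Finset α → ℝ := fun S S' =>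
    Real.exp (t * Z S) * (max (t * Z S - t * Z S') 0) ^ 2 with hF
  have h1 : ∑ S ∈ A.powersetCard k, ∑ p ∈ S, ∑ q ∈ A \ S,
      symDiv (Real.exp (t * Z S)) (Real.exp (t * Z (exch p q S))) ≤
      2 * ∑ S ∈ A.powersetCard k, ∑ p ∈ S, ∑ q ∈ A \ S, F S (exch p q S) := by
    have h2 : ∑ S ∈ A.powersetCard k, ∑ p ∈ S, ∑ q ∈ A \ S,
        symDiv (Real.exp (t * Z S)) (Real.exp (t * Z (exch p q S))) ≤
        ∑ S ∈ A.powersetCard k, ∑ p ∈ S, ∑ q ∈ A \ S, (F S (exch p q S) + F (exch p q S) S) :=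
      sum_le_sum fun S _ => sum_le_sum fun p _ => sum_le_sum fun q _ => symDiv_exp_le _ _
    refine h2.trans_eq ?_
    simp only [sum_add_distrib]
    rw [sum_exch_symm A k F]
    ring
  have h3 : ∀ S S', F S S' = t ^ 2 * (Real.exp (t * Z S) * (max (Z S - Z S') 0) ^ 2) := by
    intro S S'
    have : max (t * Z S - t * Z S') 0 = t * max (Z S - Z S') 0 := by
      rw [mul_max_of_nonneg _ _ ht, mul_zero, mul_sub]
    rw [hF]
    simp only [this]
    ring
  rw [expect_eq_sum_div_card, expect_eq_sum_div_card, mul_div_assoc', mul_div_assoc']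
  refine div_le_div_of_nonneg_right ?_ (Nat.cast_nonneg _)
  have hK' : (0 : ℝ) < K := by exact_mod_cast hK
  refine (mul_le_mul_of_nonneg_left h1 (by positivity)).trans_eq ?_
  simp only [h3, upVar, ← mul_sum]
  simp only [mul_left_comm (Real.exp _) (1 / (K : ℝ)), ← mul_sum]
  field_simp

end Slice

open Filter Topology

/-! ### From entropy bounds to exponential moments and tails. -/

section Herbst

variable {ι : Type*} {s : Finset ι}

/-- The interval omits `0` because `log M / t` has only a right limit of interest there, not a
useful value. -/
theorem le_of_hasDerivAt_nonpos {φ φ' : ℝ → ℝ} {T c : ℝ} (hT : 0 < T)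
    (h1 : ∀ t ∈ Set.Ioc 0 T, HasDerivAt φ (φ' t) t) (h2 : ∀ t ∈ Set.Ioc 0 T, φ' t ≤ 0)
    (h3 : Tendsto φ (𝓝[>] 0) (𝓝 c)) : φ T ≤ c := by
  have hanti : AntitoneOn φ (Set.Ioc 0 T) := by
    refine antitoneOn_of_deriv_nonpos (convex_Ioc 0 T)
      (fun t ht => (h1 t ht).continuousAt.continuousWithinAt) ?_ ?_
    · intro t ht
      rw [interior_Ioc] at ht
      exact (h1 t ⟨ht.1, ht.2.le⟩).differentiableAt.differentiableWithinAt
    · intro t ht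
      rw [interior_Ioc] at ht
      rw [(h1 t ⟨ht.1, ht.2.le⟩).deriv]
      exact h2 t ⟨ht.1, ht.2.le⟩
  refine ge_of_tendsto h3 ?_
  filter_upwards [Ioo_mem_nhdsGT hT] with t ht
  exact hanti ⟨ht.1, ht.2.le⟩ ⟨hT, le_rfl⟩ ht.2.le

/-- The moment generating function of `Z` under the uniform law on `s`. -/
def finMgf (s : Finset ι) (Z : ι → ℝ) (t : ℝ) : ℝ := 𝔼 i ∈ s, Real.exp (t * Z i)

theorem finMgf_pos (hs : s.Nonempty) (Z : ι → ℝ) (t : ℝ) : 0 < finMgf s Z t :=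
  expect_pos (fun _ _ => Real.exp_pos _) hs

theorem hasDerivAt_finMgf (s : Finset ι) (Z : ι → ℝ) (t : ℝ) :
    HasDerivAt (finMgf s Z) (𝔼 i ∈ s, Real.exp (t * Z i) * Z i) t := by
  have h1 : finMgf s Z = fun t => (∑ i ∈ s, Real.exp (t * Z i)) / #s := by
    funext t; rw [finMgf, expect_eq_sum_div_card]
  rw [h1, expect_eq_sum_div_card]
  refine HasDerivAt.div_const (HasDerivAt.fun_sum fun i _ => ?_) _
  simpa using ((hasDerivAt_id t).mul_const (Z i)).exp

theorem hasDerivAt_log_finMgf (hs : s.Nonempty) (Z : ι → ℝ) (t : ℝ) :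
    HasDerivAt (fun t => Real.log (finMgf s Z t))
      ((𝔼 i ∈ s, Real.exp (t * Z i) * Z i) / finMgf s Z t) t :=
  (hasDerivAt_finMgf s Z t).log (finMgf_pos hs Z t).ne'

theorem tendsto_log_finMgf_div (hs : s.Nonempty) (Z : ι → ℝ) :
    Tendsto (fun t => Real.log (finMgf s Z t) / t) (𝓝[>] 0) (𝓝 (𝔼 i ∈ s, Z i)) := by
  have h := (hasDerivAt_log_finMgf hs Z 0).tendsto_slope_zero_right
  have h0 : finMgf s Z 0 = 1 := by simp [finMgf, expect_const hs]
  simp only [zero_add, zero_mul, Real.exp_zero, one_mul, h0, Real.log_one, sub_zero, div_one,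
    smul_eq_mul] at h
  simpa [div_eq_inv_mul] using h

theorem finEnt_exp_mul (s : Finset ι) (Z : ι → ℝ) (t : ℝ) :
    finEnt s (fun i => Real.exp (t * Z i)) = t * (𝔼 i ∈ s, Real.exp (t * Z i) * Z i) -
      finMgf s Z t * Real.log (finMgf s Z t) := by
  unfold finEnt finMgf
  rw [mul_expect]
  congr 1
  exact expect_congr rfl fun i _ => by rw [Real.log_exp]; ring

/-- Since `(log M / t)' = Ent / (t ^ 2 * M)`, the hypothesis says exactly that `log M / t * (1 - t *
B)` has nonpositive derivative; at `0` it tends to the mean. -/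
theorem log_finMgf_le_of_selfBounding (hs : s.Nonempty) {Z : ι → ℝ} {B : ℝ}
    (h : ∀ t, 0 < t → finEnt s (fun i => Real.exp (t * Z i)) ≤
      t ^ 2 * (B * 𝔼 i ∈ s, Real.exp (t * Z i) * Z i)) {T : ℝ} (hT : 0 < T) (hTB : T * B < 1) :
    Real.log (finMgf s Z T) ≤ T * (𝔼 i ∈ s, Z i) / (1 - T * B) := by
  have key : Real.log (finMgf s Z T) / T * (1 - T * B) ≤ 𝔼 i ∈ s, Z i := by
    refine le_of_hasDerivAt_nonpos (φ := fun t => Real.log (finMgf s Z t) / t * (1 - t * B))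
      (φ' := fun t => (((𝔼 i ∈ s, Real.exp (t * Z i) * Z i) / finMgf s Z t * t -
        Real.log (finMgf s Z t) * 1) / t ^ 2) * (1 - t * B) +
          Real.log (finMgf s Z t) / t * (-(1 * B))) hT ?_ ?_ ?_
    · intro t ht
      exact ((hasDerivAt_log_finMgf hs Z t).div (hasDerivAt_id t) ht.1.ne').mul
        (((hasDerivAt_id t).mul_const B).const_sub 1)
    · intro t ht
      have ht0 : t ≠ 0 := ht.1.ne'
      have hM := finMgf_pos hs Z t
      have h1 := h t ht.1
      rw [finEnt_exp_mul] at h1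
      set M := finMgf s Z t
      set M' := 𝔼 i ∈ s, Real.exp (t * Z i) * Z i
      have h2 : (M' / M * t - Real.log M * 1) / t ^ 2 * (1 - t * B) +
          Real.log M / t * (-(1 * B)) =
          (t * M' - M * Real.log M - t ^ 2 * (B * M')) / (M * t ^ 2) := by
        field_simp
        ring
      rw [h2]
      exact div_nonpos_of_nonpos_of_nonneg (by linarith) (by positivity)
    · have h1 : Tendsto (fun t : ℝ => 1 - t * B) (𝓝[>] 0) (𝓝 1) := by
        have : Tendsto (fun t : ℝ => 1 - t * B) (𝓝 0) (𝓝 (1 - 0 * B)) :=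
          Continuous.tendsto (by fun_prop) 0
        simp only [zero_mul, sub_zero] at this
        exact this.mono_left nhdsWithin_le_nhds
      simpa using (tendsto_log_finMgf_div hs Z).mul h1
  rw [le_div_iff₀ (by linarith)]
  have h2 := mul_le_mul_of_nonneg_left key hT.le
  calc _ = T * (Real.log (finMgf s Z T) / T * (1 - T * B)) := by field_simp
    _ ≤ _ := h2

/-- The same argument; `t * v / (1 - t * θ)` is the primitive of `v / (1 - t * θ) ^ 2` vanishing at
`0`. -/
theorem log_finMgf_le_of_finEnt_le (hs : s.Nonempty) {Z : ι → ℝ} {v θ : ℝ} (hθ : 0 ≤ θ)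
    (h : ∀ t, 0 < t → t * θ < 1 → finEnt s (fun i => Real.exp (t * Z i)) ≤
      t ^ 2 * (v / (1 - t * θ) ^ 2) * finMgf s Z t) {T : ℝ} (hT : 0 < T) (hTθ : T * θ < 1) :
    Real.log (finMgf s Z T) ≤ T * (𝔼 i ∈ s, Z i) + T ^ 2 * (v / (1 - T * θ)) := by
  have key : Real.log (finMgf s Z T) / T - T * v / (1 - T * θ) ≤ 𝔼 i ∈ s, Z i := by
    have hpos : ∀ t ∈ Set.Ioc 0 T, 0 < 1 - t * θ := fun t ht => by
      have := mul_le_mul_of_nonneg_right ht.2 hθ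
      linarith
    refine le_of_hasDerivAt_nonpos
      (φ := fun t => Real.log (finMgf s Z t) / t - t * v / (1 - t * θ))
      (φ' := fun t => ((𝔼 i ∈ s, Real.exp (t * Z i) * Z i) / finMgf s Z t * t -
        Real.log (finMgf s Z t) * 1) / t ^ 2 -
          ((1 * v) * (1 - t * θ) - t * v * (-(1 * θ))) / (1 - t * θ) ^ 2) hT ?_ ?_ ?_
    · intro t ht
      exact ((hasDerivAt_log_finMgf hs Z t).div (hasDerivAt_id t) ht.1.ne').sub
        (((hasDerivAt_id t).mul_const v).div (((hasDerivAt_id t).mul_const θ).const_sub 1)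
          (hpos t ht).ne')
    · intro t ht
      have ht0 : t ≠ 0 := ht.1.ne'
      have hM := finMgf_pos hs Z t
      have hp := hpos t ht
      have h1 := h t ht.1 (by linarith)
      rw [finEnt_exp_mul] at h1
      set M := finMgf s Z t
      set M' := 𝔼 i ∈ s, Real.exp (t * Z i) * Z i
      have h2 : (M' / M * t - Real.log M * 1) / t ^ 2 -
          ((1 * v) * (1 - t * θ) - t * v * (-(1 * θ))) / (1 - t * θ) ^ 2 =
          (t * M' - M * Real.log M - t ^ 2 * (v / (1 - t * θ) ^ 2) * M) / (M * t ^ 2) := by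
        have : (1 * v) * (1 - t * θ) - t * v * (-(1 * θ)) = v := by ring
        rw [this]
        generalize v / (1 - t * θ) ^ 2 = w
        field_simp
      rw [h2]
      exact div_nonpos_of_nonpos_of_nonneg (by linarith) (by positivity)
    · have h1 : Tendsto (fun t : ℝ => t * v / (1 - t * θ)) (𝓝[>] 0) (𝓝 0) := by
        have hc : ContinuousAt (fun t : ℝ => t * v / (1 - t * θ)) 0 :=
          ContinuousAt.div (by fun_prop) (by fun_prop) (by simp)
        have := hc.tendsto
        simp only [zero_mul, zero_div] at this
        exact this.mono_left nhdsWithin_le_nhds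
      simpa using (tendsto_log_finMgf_div hs Z).sub h1
  have h2 := mul_le_mul_of_nonneg_left key hT.le
  have h3 : T * (Real.log (finMgf s Z T) / T - T * v / (1 - T * θ)) =
      Real.log (finMgf s Z T) - T ^ 2 * (v / (1 - T * θ)) := by
    rw [mul_sub]
    congr 1
    · field_simp
    · ring
  linarith

/-- The entropy inequality trades the product `exp (t * Z) * (a * Q + b)` for an exponential moment
of `Q`, which self-bounding controls, plus a multiple `t * θ < 1` of the entropy, absorbed on the
left. -/
theorem finEnt_le_of_decoupling (hs : s.Nonempty) {Z Q : ι → ℝ} {a b B θ : ℝ}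
    (hb : 0 ≤ b) (hθ : 0 < θ) (hθ2 : θ ^ 2 = a * B) (hQ : ∀ i ∈ s, 0 ≤ Q i)
    (ha' : 0 < a)
    (hZ : ∀ t, 0 < t → finEnt s (fun i => Real.exp (t * Z i)) ≤
      t ^ 2 * 𝔼 i ∈ s, Real.exp (t * Z i) * (a * Q i + b))
    (hQ' : ∀ t, 0 < t → finEnt s (fun i => Real.exp (t * Q i)) ≤
      t ^ 2 * (B * 𝔼 i ∈ s, Real.exp (t * Q i) * Q i))
    {t : ℝ} (ht : 0 < t) (htθ : t * θ < 1) :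
    finEnt s (fun i => Real.exp (t * Z i)) ≤
      t ^ 2 * ((a * (𝔼 i ∈ s, Q i) + b) / (1 - t * θ) ^ 2) * finMgf s Z t := by
  have h1 := hZ t ht
  -- With the scale `t / θ`, multiplying by `t * θ` restores `t ^ 2`, and the self-bounding
  -- parameter `t / θ * a * B` is again `t * θ` because `θ ^ 2 = a * B`.
  have h2 := expect_exp_mul_le hs (fun i => t * Z i) (fun i => (t / θ) * (a * Q i + b))
  have hM := finMgf_pos hs Z t
  have hd : 0 < 1 - t * θ := by linarith
  have hEQ : 0 ≤ 𝔼 i ∈ s, Q i := expect_nonneg hQ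
  have h3 : Real.log (𝔼 i ∈ s, Real.exp ((t / θ) * (a * Q i + b))) =
      (t / θ) * b + Real.log (finMgf s Q (t / θ * a)) := by
    have : 𝔼 i ∈ s, Real.exp ((t / θ) * (a * Q i + b)) =
        Real.exp ((t / θ) * b) * finMgf s Q (t / θ * a) := by
      rw [finMgf, mul_expect]
      refine expect_congr rfl fun i _ => ?_
      rw [← Real.exp_add]
      ring_nf
    rw [this, Real.log_mul (Real.exp_ne_zero _) (finMgf_pos hs _ _).ne', Real.log_exp]
  have h4 : t / θ * a * B = t * θ := by
    field_simp
    linarith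
  have h5 := log_finMgf_le_of_selfBounding hs hQ' (T := t / θ * a) (by positivity)
    (by rw [h4]; exact htθ)
  rw [h4] at h5
  have h6 : (t / θ) * b ≤ (t / θ) * b / (1 - t * θ) :=
    le_div_self (by positivity) hd (by nlinarith [mul_pos ht hθ])
  have h7 : Real.log (𝔼 i ∈ s, Real.exp ((t / θ) * (a * Q i + b))) ≤
      (t / θ) * (a * (𝔼 i ∈ s, Q i) + b) / (1 - t * θ) := by
    rw [h3]
    calc _ ≤ (t / θ) * b / (1 - t * θ) + t / θ * a * (𝔼 i ∈ s, Q i) / (1 - t * θ) :=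
          add_le_add h6 h5
      _ = _ := by ring
  set v := a * (𝔼 i ∈ s, Q i) + b with hv
  set X := 𝔼 i ∈ s, Real.exp (t * Z i) * (a * Q i + b) with hX
  set En := finEnt s (fun i => Real.exp (t * Z i)) with hEn
  have h8 : 𝔼 i ∈ s, Real.exp (t * Z i) * (t / θ * (a * Q i + b)) = (t / θ) * X := by
    rw [hX, mul_expect]
    exact expect_congr rfl fun i _ => by ring
  change _ ≤ En + finMgf s Z t * _ at h2
  rw [h8] at h2
  have h9 := h2.trans (add_le_add le_rfl (mul_le_mul_of_nonneg_left h7 hM.le))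
  have h10 := mul_le_mul_of_nonneg_left h9 (mul_pos ht hθ).le
  have h11 : t * θ * (t / θ * X) = t ^ 2 * X := by field_simp
  have h12 : t * θ * (En + finMgf s Z t * (t / θ * v / (1 - t * θ))) =
      t * θ * En + t ^ 2 * (v / (1 - t * θ)) * finMgf s Z t := by field_simp
  rw [h11, h12] at h10
  have h13 : (1 - t * θ) * En ≤ t ^ 2 * (v / (1 - t * θ)) * finMgf s Z t := by linarith
  rw [mul_comm, ← le_div_iff₀ hd] at h13
  refine h13.trans_eq ?_
  field_simp

/-- Chernoff's bound with the variance factor written as `x * y ^ 2`. Since `θ < β`, the choice `t =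
1 / (β + y)` is admissible even for `y = 0`. -/
theorem card_filter_div_card_le (hs : s.Nonempty) {Z : ι → ℝ} {x y θ β : ℝ} (hx : 0 < x)
    (hy : 0 ≤ y) (hθ : 0 < θ) (hβ : θ < β)
    (h : ∀ t, 0 < t → t * θ < 1 → Real.log (finMgf s Z t) ≤
      t * (𝔼 i ∈ s, Z i) + t ^ 2 * (x * y ^ 2 / (1 - t * θ))) :
    (#{i ∈ s | 2 * (x * y) + β * x < Z i - 𝔼 j ∈ s, Z j} : ℝ) / #s ≤ Real.exp (-x) := by
  set E := 𝔼 i ∈ s, Z i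
  set c := 2 * (x * y) + β * x with hc
  have hby : 0 < β + y := by linarith
  set t := 1 / (β + y) with ht
  have ht0 : 0 < t := by positivity
  have htθ : t * θ < 1 := by
    rw [ht, one_div_mul_eq_div, div_lt_one hby]
    linarith
  have h1 := h t ht0 htθ
  have h2 : t ^ 2 * (x * y ^ 2 / (1 - t * θ)) ≤ t * (x * y) := by
    have h3 : 1 - t * θ = t * (β - θ + y) := by
      rw [ht]; field_simp; ring
    have hp : 0 < β - θ + y := by linarith
    have h4 : t ^ 2 * (x * y ^ 2 / (1 - t * θ)) = t * (x * (y ^ 2 / (β - θ + y))) := by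
      rw [h3]; field_simp
    rw [h4]
    refine mul_le_mul_of_nonneg_left (mul_le_mul_of_nonneg_left ?_ hx.le) ht0.le
    rw [div_le_iff₀ hp]
    nlinarith
  have h3 : t * c = t * (x * y) + x := by
    rw [ht, hc]; field_simp; ring
  have hM := finMgf_pos hs Z t
  have h4 : finMgf s Z t ≤ Real.exp (t * (E + c) - x) := by
    rw [← Real.log_le_iff_le_exp hM]
    linarith
  have h5 : (#{i ∈ s | c < Z i - E} : ℝ) / #s * Real.exp (t * (E + c)) ≤ finMgf s Z t := by
    rw [finMgf, expect_eq_sum_div_card, div_mul_eq_mul_div]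
    refine div_le_div_of_nonneg_right ?_ (Nat.cast_nonneg _)
    rw [← nsmul_eq_mul]
    calc _ ≤ ∑ i ∈ s with c < Z i - E, Real.exp (t * Z i) := by
          refine card_nsmul_le_sum _ _ _ fun i hi => Real.exp_le_exp.2 ?_
          rw [mem_filter] at hi
          exact mul_le_mul_of_nonneg_left (by linarith [hi.2]) ht0.le
      _ ≤ _ := sum_le_sum_of_subset_of_nonneg (filter_subset _ _)
          fun _ _ _ => (Real.exp_pos _).le
  have h6 := h5.trans h4
  rw [sub_eq_add_neg, Real.exp_add, mul_comm (Real.exp (t * (E + c)))] at h6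
  exact le_of_mul_le_mul_right h6 (Real.exp_pos _)

end Herbst

/-! ### Suprema of averages over a random subset. -/

section Supremum

variable {α κ : Type*} [DecidableEq α]

/-- An index maximizing at `S` bounds the drop under every exchange. The supremum need not be
attained, so an index within `δ` is used and `δ → 0`; `b` only controls the cross term. -/
theorem upVar_iSup_le [Nonempty κ] {A S : Finset α} {k K : ℕ} (hSA : S ⊆ A)
    {ψ : κ → α → ℝ} {c : κ → ℝ} {b M : ℝ}
    (hbdd : ∀ S ⊆ A, BddAbove (Set.range fun j => (1 / (k : ℝ)) * ∑ a ∈ S, ψ j a - c j))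
    (hb : ∀ j, ∀ p ∈ A, ∀ q ∈ A, |ψ j p - ψ j q| ≤ b)
    (hM : ∀ j, (1 / (K : ℝ)) * ∑ p ∈ S, ∑ q ∈ A \ S,
      ((1 / (k : ℝ)) * max (ψ j p - ψ j q) 0) ^ 2 ≤ M) :
    upVar A K (fun S => ⨆ j, ((1 / (k : ℝ)) * ∑ a ∈ S, ψ j a - c j)) S ≤ M := by
  set Z : Finset α → ℝ := fun S => ⨆ j, ((1 / (k : ℝ)) * ∑ a ∈ S, ψ j a - c j) with hZ
  set C : ℝ := (1 / (K : ℝ)) * (#S * #(A \ S)) with hC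
  have key : ∀ δ : ℝ, 0 < δ → upVar A K Z S ≤ M + C * (2 * δ * ((1 / (k : ℝ)) * b) + δ ^ 2) := by
    intro δ hδ
    obtain ⟨j, hj⟩ := exists_lt_of_lt_ciSup (show Z S - δ < Z S by linarith)
    have h1 : ∀ p ∈ S, ∀ q ∈ A \ S, (max (Z S - Z (exch p q S)) 0) ^ 2 ≤
        ((1 / (k : ℝ)) * max (ψ j p - ψ j q) 0) ^ 2 +
          (2 * δ * ((1 / (k : ℝ)) * b) + δ ^ 2) := by
      intro p hp q hq
      rw [Finset.mem_sdiff] at hq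
      have h2 : (1 / (k : ℝ)) * ∑ a ∈ exch p q S, ψ j a - c j ≤ Z (exch p q S) :=
        le_ciSup (hbdd _ (exch_subset (hSA hp) hq.1 hSA)) j
      rw [sum_exch hp hq.2] at h2
      have hk : 0 ≤ 1 / (k : ℝ) := by positivity
      set w := (1 / (k : ℝ)) * max (ψ j p - ψ j q) 0 with hw
      have hw0 : 0 ≤ w := mul_nonneg hk (le_max_right _ _)
      have hwb : w ≤ (1 / (k : ℝ)) * b := by
        refine mul_le_mul_of_nonneg_left (max_le ?_ ?_) hk
        · exact (le_abs_self _).trans (hb j p (hSA hp) q hq.1)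
        · exact (abs_nonneg _).trans (hb j p (hSA hp) q hq.1)
      have h3 : (1 / (k : ℝ)) * (ψ j p - ψ j q) ≤ w :=
        mul_le_mul_of_nonneg_left (le_max_left _ _) hk
      have h4 : max (Z S - Z (exch p q S)) 0 ≤ w + δ := by
        refine max_le ?_ (by linarith)
        linarith
      have h5 := pow_le_pow_left₀ (le_max_right _ _) h4 2
      nlinarith [mul_le_mul_of_nonneg_left hwb hδ.le]
    have h2 : upVar A K Z S ≤ (1 / (K : ℝ)) * ∑ p ∈ S, ∑ q ∈ A \ S,
        (((1 / (k : ℝ)) * max (ψ j p - ψ j q) 0) ^ 2 +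
          (2 * δ * ((1 / (k : ℝ)) * b) + δ ^ 2)) :=
      mul_le_mul_of_nonneg_left (sum_le_sum fun p hp => sum_le_sum fun q hq => h1 p hp q hq)
        (by positivity)
    refine h2.trans ?_
    simp only [sum_add_distrib (s := S), sum_add_distrib (s := A \ S), sum_const, nsmul_eq_mul]
    have := hM j
    rw [hC]
    linarith
  have hlim : Tendsto (fun δ : ℝ => M + C * (2 * δ * ((1 / (k : ℝ)) * b) + δ ^ 2)) (𝓝[>] 0)
      (𝓝 M) := by
    have : Tendsto (fun δ : ℝ => M + C * (2 * δ * ((1 / (k : ℝ)) * b) + δ ^ 2)) (𝓝 0)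
        (𝓝 (M + C * (2 * 0 * ((1 / (k : ℝ)) * b) + 0 ^ 2))) :=
      Continuous.tendsto (by fun_prop) 0
    simp only [mul_zero, zero_mul, ne_eq, OfNat.ofNat_ne_zero, not_false_eq_true, zero_pow,
      add_zero] at this
    exact this.mono_left nhdsWithin_le_nhds
  refine ge_of_tendsto hlim ?_
  filter_upwards [self_mem_nhdsWithin] with δ hδ using key δ hδ

theorem expect_powersetCard_sum {A : Finset α} {k K : ℕ} (hk : 0 < k) (hA : #A = k + K)
    (f : α → ℝ) :
    𝔼 S ∈ A.powersetCard k, (1 / (k : ℝ)) * ∑ a ∈ S, f a =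
      (1 / ((k + K : ℕ) : ℝ)) * ∑ a ∈ A, f a := by
  obtain ⟨l, rfl⟩ : ∃ l, k = l + 1 := ⟨k - 1, by omega⟩
  rw [← mul_expect, expect_powersetCard_succ hA (fun a _ => f a)]
  have h : ∀ a ∈ A, 𝔼 T ∈ (A.erase a).powersetCard l, f a = f a := fun a ha =>
    expect_const (powersetCard_nonempty.2 (by rw [card_erase_of_mem ha]; omega)) _
  rw [expect_congr rfl h, expect_eq_sum_div_card, hA]
  push_cast
  field_simp

theorem two_mul_sqrt_le_iInf {R y : ℝ} (hR : 0 ≤ R) (hy : 0 ≤ y) :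
    2 * √(R * y) ≤ ⨅ α : Set.Ioi (0 : ℝ), (R / (α : ℝ) + (α : ℝ) * y) := by
  have : Nonempty (Set.Ioi (0 : ℝ)) := ⟨⟨1, Set.mem_Ioi.2 one_pos⟩⟩
  refine le_ciInf fun ⟨a, ha⟩ => ?_
  have ha' : 0 < a := ha
  have h1 : √(R * y) = √(R / a) * √(a * y) := by
    rw [← Real.sqrt_mul (by positivity)]
    congr 1
    field_simp
  have h2 := Real.sq_sqrt (show 0 ≤ R / a by positivity)
  have h3 := Real.sq_sqrt (show 0 ≤ a * y by positivity)
  rw [h1]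
  simp only
  nlinarith [sq_nonneg (√(R / a) - √(a * y))]

variable [Nonempty κ] {A : Finset α} {k K : ℕ} {h : κ → α → ℝ} {H₀ r x : ℝ}

/-- Bound `(h p - h q)₊ ^ 2` by `2 * h p ^ 2 + 2 * h q ^ 2`. Points of `S` contribute `q`; the mean
square over the complement is at most `2 * r`, as `k ≤ K`. -/
theorem upVar_iSup_sum_le (hk : 0 < k) (hK : 0 < K) (hkK : k ≤ K) (hA : #A = k + K)
    (hb : ∀ j, ∀ a ∈ A, |h j a| ≤ H₀)
    (hr : ∀ j, (1 / ((k + K : ℕ) : ℝ)) * ∑ a ∈ A, h j a ^ 2 ≤ r)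
    {S : Finset α} (hS : S ∈ A.powersetCard k) {q : ℝ}
    (hq : ∀ j, (1 / (k : ℝ)) * ∑ a ∈ S, h j a ^ 2 ≤ q) :
    upVar A K (fun S => ⨆ j, (1 / (k : ℝ)) * ∑ a ∈ S, h j a) S ≤
      (2 / k) * q + 4 * r / k := by
  rw [mem_powersetCard] at hS
  have hk' : (0 : ℝ) < k := by exact_mod_cast hk
  have hK' : (0 : ℝ) < K := by exact_mod_cast hK
  have hkK' : (k : ℝ) ≤ K := by exact_mod_cast hkK
  have hfun : (fun S => ⨆ j, (1 / (k : ℝ)) * ∑ a ∈ S, h j a) =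
      fun S => ⨆ j, ((1 / (k : ℝ)) * ∑ a ∈ S, h j a - (fun _ : κ => (0 : ℝ)) j) := by
    simp
  rw [hfun]
  refine upVar_iSup_le (b := H₀ + H₀) hS.1 (fun S hSA => ⟨(1 / (k : ℝ)) * ∑ a ∈ S, H₀, ?_⟩)
    (fun j p hp q hq => (abs_sub _ _).trans (add_le_add (hb j p hp) (hb j q hq))) fun j => ?_
  · rintro _ ⟨j, rfl⟩
    simp only [sub_zero]
    exact mul_le_mul_of_nonneg_left (sum_le_sum fun a ha => (le_abs_self _).trans
      (hb j a (hSA ha))) (by positivity)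
  · have h1 : ∀ p q, ((1 / (k : ℝ)) * max (h j p - h j q) 0) ^ 2 ≤
        (1 / (k : ℝ) ^ 2) * (2 * h j p ^ 2 + 2 * h j q ^ 2) := by
      intro p q
      rw [mul_pow, one_div_pow]
      refine mul_le_mul_of_nonneg_left ?_ (by positivity)
      rcases max_cases (h j p - h j q) 0 with ⟨h', _⟩ | ⟨h', _⟩ <;> rw [h']
      · nlinarith [sq_nonneg (h j p + h j q)]
      · nlinarith [sq_nonneg (h j p), sq_nonneg (h j q)]
    have hc : #(A \ S) = K := by rw [card_sdiff_of_subset hS.1, hA, hS.2]; omega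
    have h2 := hr j
    rw [← sum_sdiff hS.1] at h2
    have h3 := hq j
    have h4 : (1 / (K : ℝ)) * ∑ p ∈ S, ∑ q ∈ A \ S,
        ((1 / (k : ℝ)) * max (h j p - h j q) 0) ^ 2 ≤ (1 / (K : ℝ)) * ∑ p ∈ S, ∑ q ∈ A \ S,
          (1 / (k : ℝ) ^ 2) * (2 * h j p ^ 2 + 2 * h j q ^ 2) :=
      mul_le_mul_of_nonneg_left (sum_le_sum fun p _ => sum_le_sum fun q _ => h1 p q)
        (by positivity)
    refine h4.trans ?_
    simp only [← mul_sum, sum_add_distrib, sum_const, hS.2, hc, nsmul_eq_mul]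
    set X := ∑ a ∈ S, h j a ^ 2
    set Y := ∑ a ∈ A \ S, h j a ^ 2
    have hX : 0 ≤ X := sum_nonneg fun _ _ => sq_nonneg _
    have hY : 0 ≤ Y := sum_nonneg fun _ _ => sq_nonneg _
    have hkK0 : (0 : ℝ) < ((k + K : ℕ) : ℝ) := by positivity
    have h5 : (1 / (K : ℝ)) * Y ≤ 2 * r := by
      rw [one_div_mul_eq_div, div_le_iff₀ hkK0] at h2
      rw [one_div_mul_eq_div, div_le_iff₀ hK']
      have hr0 : 0 ≤ r := by
        by_contra hneg
        push Not at hneg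
        nlinarith
      push_cast at h2
      nlinarith
    calc _ = (2 / k) * ((1 / k) * X) + (2 / k) * ((1 / K) * Y) := by field_simp
      _ ≤ (2 / k) * q + (2 / k) * (2 * r) := by gcongr
      _ = _ := by ring

/-- The self-bounding property: a drop `(h p ^ 2 - h q ^ 2)₊` is at most `h p ^ 2`, whose square is
at most `H₀ ^ 2 * h p ^ 2`. -/
theorem upVar_iSup_sum_sq_le (hk : 0 < k) (hK : 0 < K) (hA : #A = k + K)
    (hb : ∀ j, ∀ a ∈ A, |h j a| ≤ H₀) {c : κ → ℝ} (hc : ∀ j, 0 ≤ c j)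
    {S : Finset α} (hS : S ∈ A.powersetCard k) {q : ℝ}
    (hq : ∀ j, (1 / (k : ℝ)) * ∑ a ∈ S, h j a ^ 2 ≤ q) :
    upVar A K (fun S => ⨆ j, ((1 / (k : ℝ)) * ∑ a ∈ S, h j a ^ 2 - c j)) S ≤
      H₀ ^ 2 / k * q := by
  rw [mem_powersetCard] at hS
  have hk' : (0 : ℝ) < k := by exact_mod_cast hk
  have hK' : (0 : ℝ) < K := by exact_mod_cast hK
  have hsq : ∀ j, ∀ a ∈ A, h j a ^ 2 ≤ H₀ ^ 2 := fun j a ha => sq_le_sq'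
    (by linarith [neg_abs_le (h j a), hb j a ha]) ((le_abs_self _).trans (hb j a ha))
  refine upVar_iSup_le (b := H₀ ^ 2) hS.1
    (fun S hSA => ⟨(1 / (k : ℝ)) * ∑ a ∈ S, H₀ ^ 2, ?_⟩) (fun j p hp q hq => ?_) fun j => ?_
  · rintro _ ⟨j, rfl⟩
    have : (1 / (k : ℝ)) * ∑ a ∈ S, h j a ^ 2 ≤ (1 / (k : ℝ)) * ∑ a ∈ S, H₀ ^ 2 :=
      mul_le_mul_of_nonneg_left (sum_le_sum fun a ha => hsq j a (hSA ha)) (by positivity)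
    have := hc j
    simp only
    linarith
  · rw [abs_le]
    constructor <;> linarith [hsq j p hp, hsq j q hq, sq_nonneg (h j p), sq_nonneg (h j q)]
  · have hcard : #(A \ S) = K := by rw [card_sdiff_of_subset hS.1, hA, hS.2]; omega
    have h1 : ∀ p ∈ S, ∀ q ∈ A \ S, ((1 / (k : ℝ)) * max (h j p ^ 2 - h j q ^ 2) 0) ^ 2 ≤
        (1 / (k : ℝ) ^ 2) * (H₀ ^ 2 * h j p ^ 2) := by
      intro p hp q _
      rw [mul_pow, one_div_pow]
      refine mul_le_mul_of_nonneg_left ?_ (by positivity)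
      have h2 : max (h j p ^ 2 - h j q ^ 2) 0 ≤ h j p ^ 2 :=
        max_le (by linarith [sq_nonneg (h j q)]) (sq_nonneg _)
      calc _ ≤ (h j p ^ 2) ^ 2 := pow_le_pow_left₀ (le_max_right _ _) h2 2
        _ = h j p ^ 2 * h j p ^ 2 := by ring
        _ ≤ _ := mul_le_mul_of_nonneg_right (hsq j p (hS.1 hp)) (sq_nonneg _)
    have h4 : (1 / (K : ℝ)) * ∑ p ∈ S, ∑ q ∈ A \ S,
        ((1 / (k : ℝ)) * max (h j p ^ 2 - h j q ^ 2) 0) ^ 2 ≤ (1 / (K : ℝ)) * ∑ p ∈ S,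
          ∑ q ∈ A \ S, (1 / (k : ℝ) ^ 2) * (H₀ ^ 2 * h j p ^ 2) :=
      mul_le_mul_of_nonneg_left (sum_le_sum fun p hp => sum_le_sum fun q hq => h1 p hp q hq)
        (by positivity)
    refine h4.trans ?_
    simp only [← mul_sum, sum_const, hcard, nsmul_eq_mul]
    calc _ = H₀ ^ 2 / k * ((1 / k) * ∑ a ∈ S, h j a ^ 2) := by field_simp
      _ ≤ _ := mul_le_mul_of_nonneg_left (hq j) (by positivity)

/-- Concentration of the supremum of the averages over a uniformly random `k`-element subset
of a finite population. -/
theorem card_iSup_deviation_le (hk : 0 < k) (hK : 0 < K) (hkK : k ≤ K) (hA : #A = k + K)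
    (hH₀ : 2 * √2 ≤ H₀) (hb : ∀ j, ∀ a ∈ A, |h j a| ≤ H₀)
    (hr : ∀ j, (1 / ((k + K : ℕ) : ℝ)) * ∑ a ∈ A, h j a ^ 2 ≤ r) (hx : 0 < x)
    {c : ℝ} (hc : 2 ≤ c) {G : Finset α → ℝ}
    (hG : G = fun S => ⨆ j, (1 / (k : ℝ)) * ∑ a ∈ S, h j a) {R : ℝ}
    (hR : R = 𝔼 S ∈ A.powersetCard k, ⨆ j, ((1 / (k : ℝ)) * ∑ a ∈ S, h j a ^ 2 -
      (1 / ((k + K : ℕ) : ℝ)) * ∑ a ∈ A, h j a ^ 2)) :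
    (#{S ∈ A.powersetCard k | c * (2 * √(3 * r * x / k) +
        (⨅ α : Set.Ioi (0 : ℝ), (R / (α : ℝ) + (α : ℝ) * x / k)) + 2 * H₀ ^ 2 * x / k) <
        G S - 𝔼 S' ∈ A.powersetCard k, G S'} : ℝ) / #(A.powersetCard k) ≤ Real.exp (-x) := by
  have hk' : (0 : ℝ) < k := by exact_mod_cast hk
  have hK' : (0 : ℝ) < K := by exact_mod_cast hK
  have hH : 0 < H₀ := lt_of_lt_of_le (by positivity) hH₀
  have hne : (A.powersetCard k).Nonempty := powersetCard_nonempty.2 (by omega)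
  set T : κ → ℝ := fun j => (1 / ((k + K : ℕ) : ℝ)) * ∑ a ∈ A, h j a ^ 2 with hT
  have hT0 : ∀ j, 0 ≤ T j := fun j => mul_nonneg (by positivity) (sum_nonneg fun _ _ => sq_nonneg _)
  have j₀ : κ := Classical.arbitrary κ
  have hr0 : 0 ≤ r := (hT0 j₀).trans (hr j₀)
  set Q : Finset α → ℝ := fun S => ⨆ j, ((1 / (k : ℝ)) * ∑ a ∈ S, h j a ^ 2 - T j) with hQ
  have hle : ∀ S ∈ A.powersetCard k, ∀ j, (1 / (k : ℝ)) * ∑ a ∈ S, h j a ^ 2 - T j ≤ Q S := by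
    intro S hS
    refine le_ciSup (f := fun j => (1 / (k : ℝ)) * ∑ a ∈ S, h j a ^ 2 - T j)
      ⟨(1 / (k : ℝ)) * ∑ a ∈ S, H₀ ^ 2, ?_⟩
    rintro _ ⟨j, rfl⟩
    have : (1 / (k : ℝ)) * ∑ a ∈ S, h j a ^ 2 ≤ (1 / (k : ℝ)) * ∑ a ∈ S, H₀ ^ 2 := by
      refine mul_le_mul_of_nonneg_left (sum_le_sum fun a ha => ?_) (by positivity)
      have haA := hb j a ((mem_powersetCard.1 hS).1 ha)
      exact sq_le_sq' (by linarith [neg_abs_le (h j a)]) ((le_abs_self _).trans haA)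
    have := hT0 j
    simp only
    linarith
  -- The shift by `r` undoes the centring, as `T j ≤ r`, and leaves `upVar` unchanged.
  have hQr : ∀ S ∈ A.powersetCard k, ∀ j, (1 / (k : ℝ)) * ∑ a ∈ S, h j a ^ 2 ≤ Q S + r := by
    intro S hS j
    linarith [hle S hS j, hr j]
  have hQ0 : ∀ S ∈ A.powersetCard k, 0 ≤ Q S + r := fun S hS =>
    (mul_nonneg (by positivity) (sum_nonneg fun _ _ => sq_nonneg _)).trans (hQr S hS j₀)
  have hEQ : 𝔼 S ∈ A.powersetCard k, (Q S + r) = R + r := by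
    rw [expect_add_distrib, expect_const hne, hR]
  have hR0 : 0 ≤ R := by
    have h1 := expect_le_expect fun S hS => hle S hS j₀
    rw [expect_sub_distrib, expect_const hne, expect_powersetCard_sum hk hA] at h1
    rw [hR]
    linarith
  -- The solution of `θ ^ 2 = a * B` for `a = 2 / k` and `B = H₀ ^ 2 / k`.
  set θ : ℝ := √2 * H₀ / k with hθ
  have hθ0 : 0 < θ := by positivity
  have hθ2 : θ ^ 2 = 2 / k * (H₀ ^ 2 / k) := by
    rw [hθ, div_pow, mul_pow, Real.sq_sqrt (by norm_num)]
    field_simp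
  have hent : ∀ t, 0 < t → t * θ < 1 →
      finEnt (A.powersetCard k) (fun S => Real.exp (t * G S)) ≤
        t ^ 2 * ((2 / k * (R + r) + 4 * r / k) / (1 - t * θ) ^ 2) *
          finMgf (A.powersetCard k) G t := by
    intro t ht htθ
    have := finEnt_le_of_decoupling (Z := G) (Q := fun S => Q S + r) (a := 2 / k)
      (b := 4 * r / k) (B := H₀ ^ 2 / k) hne (by positivity) hθ0 hθ2 hQ0 (by positivity)
      ?_ ?_ ht htθ
    · rwa [hEQ] at this
    · intro t ht
      refine (finEnt_exp_le_upVar hK hA G ht.le).trans ?_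
      refine mul_le_mul_of_nonneg_left (expect_le_expect fun S hS => ?_) (by positivity)
      refine mul_le_mul_of_nonneg_left ?_ (Real.exp_pos _).le
      rw [hG]
      exact upVar_iSup_sum_le hk hK hkK hA hb hr hS (hQr S hS)
    · intro t ht
      refine (finEnt_exp_le_upVar hK hA (fun S => Q S + r) ht.le).trans ?_
      refine mul_le_mul_of_nonneg_left ?_ (by positivity)
      rw [mul_expect]
      refine expect_le_expect fun S hS => ?_
      rw [mul_left_comm]
      refine mul_le_mul_of_nonneg_left ?_ (Real.exp_pos _).le
      have : upVar A K (fun S => Q S + r) S = upVar A K Q S := by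
        simp [upVar]
      rw [this]
      exact upVar_iSup_sum_sq_le hk hK hA hb hT0 hS (hQr S hS)
  set v := 2 / k * (R + r) + 4 * r / k with hv
  have hv0 : 0 ≤ v := by positivity
  set y := √(v / x) with hy
  have hy2 : x * y ^ 2 = v := by
    rw [hy, Real.sq_sqrt (by positivity)]
    field_simp
  have hsqrt2 : √2 ^ 2 = 2 := Real.sq_sqrt (by norm_num)
  have hsqrt2' : 1 < √2 := by nlinarith [Real.sqrt_nonneg 2]
  have hβ : θ < 4 * H₀ ^ 2 / k := by
    rw [hθ]
    refine div_lt_div_of_pos_right ?_ hk'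
    nlinarith
  have htail := card_filter_div_card_le hne hx (Real.sqrt_nonneg (v / x)) hθ0 hβ
    (Z := G) fun t ht htθ => by
      rw [← hy, hy2]
      exact log_finMgf_le_of_finEnt_le hne hθ0.le hent ht htθ
  refine le_trans (div_le_div_of_nonneg_right ?_ (Nat.cast_nonneg _)) htail
  rw [Nat.cast_le]
  refine card_le_card (monotone_filter_right _ fun S _ hS => lt_of_le_of_lt ?_ hS)
  rw [← hy]
  have hinf : 2 * √(R * (x / k)) ≤ ⨅ α : Set.Ioi (0 : ℝ), (R / (α : ℝ) + (α : ℝ) * x / k) := by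
    simp only [mul_div_assoc]
    exact two_mul_sqrt_le_iInf hR0 (by positivity)
  -- Here `(x * y) ^ 2 = x * v`. The infimum over `α` dominates the last root, and doubling the
  -- bound is paid for by `2 ≤ c`.
  have hxy : x * y ≤ 2 * √(3 * r * x / k) + 2 * √(R * (x / k)) := by
    refine le_of_sq_le_sq ?_ (by positivity)
    have h1 := Real.sq_sqrt (show 0 ≤ 3 * r * x / k by positivity)
    have h2 := Real.sq_sqrt (show 0 ≤ R * (x / k) by positivity)
    have h3 : (x * y) ^ 2 = 2 * (3 * r * x / k) + 2 * (R * (x / k)) := by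
      calc (x * y) ^ 2 = x * (x * y ^ 2) := by ring
        _ = _ := by rw [hy2, hv]; ring
    have h4 := mul_nonneg (Real.sqrt_nonneg (3 * r * x / k)) (Real.sqrt_nonneg (R * (x / k)))
    rw [h3]
    nlinarith [sq_nonneg (√(3 * r * x / k)), sq_nonneg (√(R * (x / k)))]
  have h5 : 4 * H₀ ^ 2 / k * x = 2 * (2 * H₀ ^ 2 * x / k) := by ring
  have h6 : 0 ≤ 2 * H₀ ^ 2 * x / k := by positivity
  have h7 := Real.sqrt_nonneg (3 * r * x / k)
  have h8 := Real.sqrt_nonneg (R * (x / k))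
  exact le_trans (by linarith) (mul_le_mul_of_nonneg_right hc (by linarith))

end Supremum

/-! ### RANDPERM produces a uniformly random subset. -/

section Draws

theorem randPermArray_succ {m u : ℕ} (d : Draws m u) (i : Fin u) :
    randPermArray d (i + 1) = randPermArray d i *
      Equiv.swap (Fin.castLE (Nat.le_add_left u m) i) (d i).1 := by
  rw [randPermArray, dif_pos i.2]

/-- Rounds after round `i` only swap positions beyond `i`, so the entry there is final. -/
theorem randPermArray_castLE {m u : ℕ} (d : Draws m u) (i : Fin u) (l : ℕ) (h1 : i < l)
    (h2 : l ≤ u) :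
    randPermArray d l (Fin.castLE (Nat.le_add_left u m) i) = randPerm d i := by
  induction l, h1 using Nat.le_induction with
  | base =>
    rw [Nat.succ_eq_add_one, randPermArray_succ, Equiv.Perm.mul_apply, Equiv.swap_apply_left]
    rfl
  | succ l hl ih =>
    have h3 := randPermArray_succ d ⟨l, by omega⟩
    simp only at h3
    rw [h3, Equiv.Perm.mul_apply, Equiv.swap_apply_of_ne_of_ne, ih (by omega)]
    · intro h
      have := congrArg Fin.val h
      simp at this
      omega
    · intro h
      have h4 := (d ⟨l, by omega⟩).2
      rw [← h, Fin.le_def] at h4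
      simp at h4
      omega

theorem randPerm_injective {m u : ℕ} (d : Draws m u) : Function.Injective (randPerm d) := by
  intro i j h
  rw [← randPermArray_castLE d i u i.2 le_rfl, ← randPermArray_castLE d j u j.2 le_rfl] at h
  exact Fin.castLE_injective _ ((randPermArray d u).injective h)

/-- The output of RANDPERM as an embedding. -/
def randPermEmb {m u : ℕ} (d : Draws m u) : Fin u ↪ Fin (m + u) :=
  ⟨randPerm d, randPerm_injective d⟩

/-- The draws are recovered in turn: earlier draws fix the array `I`, and `I` being a permutation,
`I (d i)` determines `d i`. -/
theorem randPermEmb_injective {m u : ℕ} :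
    Function.Injective (randPermEmb : Draws m u → (Fin u ↪ Fin (m + u))) := by
  intro d d' h
  have h0 : ∀ i, randPerm d i = randPerm d' i := fun i => DFunLike.congr_fun h i
  have hstep : ∀ i : Fin u, randPermArray d i = randPermArray d' i → d i = d' i := by
    intro i hi
    have h1 := h0 i
    unfold randPerm at h1
    rw [hi] at h1
    exact Subtype.ext ((randPermArray d' i).injective h1)
  have harr : ∀ k, k ≤ u → randPermArray d k = randPermArray d' k := by
    intro k
    induction k with
    | zero => intro _; rfl
    | succ k ih =>
      intro hk
      have h1 := ih (by omega)
      rw [randPermArray, randPermArray, dif_pos (by omega), dif_pos (by omega), h1,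
        hstep ⟨k, by omega⟩ h1]
  funext i
  exact hstep i (harr i i.2.le)

theorem card_draws (m u : ℕ) : Fintype.card (Draws m u) = (m + u).descFactorial u := by
  rw [Fintype.card_pi, Nat.descFactorial_eq_prod_range,
    ← Fin.prod_univ_eq_prod_range (fun i => m + u - i)]
  refine Finset.prod_congr rfl fun i _ => ?_
  rw [Fintype.card_subtype]
  have : ({x | Fin.castLE (Nat.le_add_left u m) i ≤ x} : Finset (Fin (m + u))) =
      Finset.Ici (Fin.castLE (Nat.le_add_left u m) i) := by
    ext; simp
  rw [this, Fin.card_Ici]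
  simp

theorem randPermEmb_bijective {m u : ℕ} :
    Function.Bijective (randPermEmb : Draws m u → (Fin u ↪ Fin (m + u))) := by
  rw [Fintype.bijective_iff_injective_and_card]
  refine ⟨randPermEmb_injective, ?_⟩
  rw [card_draws, Fintype.card_embedding_eq, Fintype.card_fin, Fintype.card_fin]

theorem testIdx_eq_map {m u : ℕ} (d : Draws m u) : testIdx d = univ.map (randPermEmb d) := by
  rw [Finset.map_eq_image]; rfl

theorem card_testIdx {m u : ℕ} (d : Draws m u) : #(testIdx d) = u := by
  simp [testIdx_eq_map]

instance nonempty_draws (m u : ℕ) : Nonempty (Draws m u) := ⟨fun _ => ⟨_, le_rfl⟩⟩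

/-- A permutation carrying `S` to `S'` acts injectively on embeddings. Used in both directions, it
makes all fibres of `testIdx` equally large. -/
theorem card_embedding_fiber_le {ι α : Type*} [Fintype ι] [Fintype α] [DecidableEq α]
    [DecidableEq ι] {S S' : Finset α} (h : #S = #S') :
    #{e : ι ↪ α | univ.map e = S} ≤ #{e : ι ↪ α | univ.map e = S'} := by
  set σ : Equiv.Perm α := (Finset.equivOfCardEq h).extendSubtype with hσ
  refine Finset.card_le_card_of_injOn (fun e => e.trans σ.toEmbedding) ?_ ?_
  · intro e he
    simp only [coe_filter, mem_univ, true_and, Set.mem_ofPred_eq] at he ⊢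
    rw [← Finset.map_map, he]
    refine Finset.eq_of_subset_of_card_le ?_ (by simp [h])
    intro y hy
    rw [Finset.mem_map] at hy
    obtain ⟨x, hx, rfl⟩ := hy
    exact Equiv.extendSubtype_mem _ x hx
  · intro e _ e' _ he
    ext x
    have := DFunLike.congr_fun he x
    exact σ.injective this

theorem card_testIdx_fiber {m u : ℕ} (S : Finset (Fin (m + u))) :
    #{d : Draws m u | testIdx d = S} = #{e : Fin u ↪ Fin (m + u) | univ.map e = S} := by
  refine Finset.card_bijective _ randPermEmb_bijective fun d => ?_
  simp [testIdx_eq_map]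

theorem expect_comp_of_card_fiber {D β : Type*} [Fintype D] [Nonempty D] [DecidableEq β]
    {g : D → β} {t : Finset β} (hg : ∀ d, g d ∈ t) {c : ℕ}
    (hc : ∀ b ∈ t, #{d | g d = b} = c) (F : β → ℝ) :
    𝔼 d, F (g d) = 𝔼 b ∈ t, F b := by
  have h1 : ∑ d, F (g d) = c * ∑ b ∈ t, F b := by
    rw [← Finset.sum_fiberwise_of_maps_to (fun d _ => hg d), mul_sum]
    refine sum_congr rfl fun b hb => ?_
    rw [sum_congr rfl (fun d hd => by rw [(mem_filter.1 hd).2] :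
      ∀ d ∈ ({d | g d = b} : Finset D), F (g d) = F b), sum_const, hc b hb, nsmul_eq_mul]
  have h2 : (#(univ : Finset D) : ℝ) = c * #t := by
    rw [Finset.card_eq_sum_card_fiberwise (f := g) (t := t) (fun d _ => hg d), sum_congr rfl hc]
    simp [mul_comm]
  have h3 : (#(univ : Finset D) : ℝ) ≠ 0 := by simp
  rw [expect_eq_sum_div_card, expect_eq_sum_div_card, h1, h2]
  rw [h2] at h3
  exact mul_div_mul_left _ _ (left_ne_zero_of_mul h3)

theorem expect_testIdx {m u : ℕ} (F : Finset (Fin (m + u)) → ℝ) :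
    𝔼 d : Draws m u, F (testIdx d) = 𝔼 S ∈ univ.powersetCard u, F S := by
  obtain ⟨d₀⟩ := nonempty_draws m u
  refine expect_comp_of_card_fiber (c := #{d : Draws m u | testIdx d = testIdx d₀})
    (fun d => mem_powersetCard.2 ⟨subset_univ _, card_testIdx d⟩) (fun S hS => ?_) F
  have h : #S = #(testIdx d₀) := by rw [card_testIdx, (mem_powersetCard.1 hS).2]
  rw [card_testIdx_fiber, card_testIdx_fiber]
  exact le_antisymm (card_embedding_fiber_le h) (card_embedding_fiber_le h.symm)

theorem expect_trainIdx {m u : ℕ} (F : Finset (Fin (m + u)) → ℝ) :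
    𝔼 d : Draws m u, F (trainIdx d) = 𝔼 S ∈ univ.powersetCard m, F S := by
  unfold trainIdx
  rw [expect_testIdx (fun S => F Sᶜ)]
  refine expect_nbij' compl compl ?_ ?_ ?_ ?_ ?_
  · intro S hS
    simp only [mem_powersetCard, subset_univ, true_and, card_compl, Fintype.card_fin] at hS ⊢
    omega
  · intro S hS
    simp only [mem_powersetCard, subset_univ, true_and, card_compl, Fintype.card_fin] at hS ⊢
    omega
  · simp
  · simp
  · simp

theorem drawLaw_real_singleton {m u : ℕ} (d : Draws m u) :
    (drawLaw m u).real {d} = 1 / (Fintype.card (Draws m u) : ℝ) := by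
  have : ∀ i : Fin u, IsProbabilityMeasure
      (uniformOn (Set.univ : Set {k : Fin (m + u) //
        Fin.castLE (Nat.le_add_left u m) i ≤ k})) := fun i =>
    isProbabilityMeasure_uniformOn Set.finite_univ ⟨⟨_, le_refl _⟩, Set.mem_univ _⟩
  rw [measureReal_def, drawLaw, Measure.pi_singleton, ENNReal.toReal_prod, Fintype.card_pi]
  push_cast
  rw [one_div, ← Finset.prod_inv_distrib]
  refine Finset.prod_congr rfl fun i _ => ?_
  rw [ProbabilityTheory.uniformOn_univ, Measure.count_singleton, ENNReal.toReal_div]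
  simp

theorem integral_drawLaw {m u : ℕ} (f : Draws m u → ℝ) :
    ∫ d, f d ∂(drawLaw m u) = 𝔼 d, f d := by
  rw [integral_fintype Integrable.of_finite, expect_eq_sum_div_card, Finset.sum_div]
  refine Finset.sum_congr rfl fun d _ => ?_
  rw [drawLaw_real_singleton, smul_eq_mul, Finset.card_univ]
  ring

theorem drawLaw_real_setOf {m u : ℕ} (P : Draws m u → Prop) [DecidablePred P] :
    (drawLaw m u).real {d | P d} = 𝔼 d, if P d then (1 : ℝ) else 0 := by
  rw [← integral_drawLaw, ← integral_indicator_one (Set.toFinite _).measurableSet]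
  refine integral_congr_ae (Filter.Eventually.of_forall fun d => ?_)
  simp [Set.indicator_apply]

theorem expect_ite_eq_card_div {ι : Type*} (s : Finset ι) (P : ι → Prop) [DecidablePred P] :
    (𝔼 i ∈ s, if P i then (1 : ℝ) else 0) = (#{i ∈ s | P i} : ℝ) / #s := by
  rw [expect_eq_sum_div_card, Finset.sum_boole]

theorem one_sub_le_drawLaw_real {m u : ℕ} {P : Draws m u → Prop} {p : ℝ}
    (h : (drawLaw m u).real {d | ¬ P d} ≤ p) : 1 - p ≤ (drawLaw m u).real {d | P d} := by
  have h1 : (drawLaw m u).real {d | P d}ᶜ = 1 - (drawLaw m u).real {d | P d} :=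
    probReal_compl_eq_one_sub (Set.toFinite _).measurableSet
  rw [Set.compl_ofPred] at h1
  linarith

end Draws

/-! ### The two regimes `u ≤ m` and `m < u`. -/

theorem iSup_squareClass {S : Type*} (H : Set (S → ℝ)) (F : (S → ℝ) → ℝ) :
    ⨆ f : squareClass H, F f.1 = ⨆ h : H, F (fun p => h.1 p ^ 2) := by
  have hsurj : Function.Surjective
      (fun h : H => (⟨fun p => h.1 p ^ 2, h.1, h.2, rfl⟩ : squareClass H)) := by
    rintro ⟨f, h, hh, rfl⟩
    exact ⟨⟨h, hh⟩, rfl⟩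
  exact (hsurj.iSup_comp (fun f : squareClass H => F f.1)).symm

/-- The values sum to zero over the sample, so the test sum is minus the training sum. -/
theorem testAvg_eq_trainAvg_neg {S : Type*} {m u : ℕ} (hm : 0 < m)
    {z : Fin (m + u) → S} (d : Draws m u) {h : S → ℝ} (hzero : fullAvg z h = 0) :
    testAvg z d h = (m / u : ℝ) * ((1 / (m : ℝ)) * ∑ i ∈ trainIdx d, -h (z i)) := by
  have hm' : (m : ℝ) ≠ 0 := by positivity
  have h1 : ∑ i, h (z i) = 0 := by
    unfold fullAvg at hzero
    have hn : ((m + u : ℕ) : ℝ) ≠ 0 := by positivity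
    rcases mul_eq_zero.1 hzero with h | h
    · exact absurd h (one_div_ne_zero hn)
    · exact h
  rw [← Finset.sum_add_sum_compl (testIdx d)] at h1
  rw [Finset.sum_neg_distrib]
  unfold testAvg trainIdx
  rw [eq_neg_of_add_eq_zero_left h1]
  field_simp

section Deviation

variable {S : Type*} {m u : ℕ} {z : Fin (m + u) → S} {H : Set (S → ℝ)} {H₀ r x : ℝ}

theorem supTest_deviation_of_le (hm : 0 < m) (hu : 0 < u) (hum : u ≤ m) (hH : H.Nonempty)
    (hH₀ : 2 * √2 ≤ H₀) (hbound : ∀ h ∈ H, ∀ i, |h (z i)| ≤ H₀)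
    (hr : ∀ h ∈ H, fullSqAvg z h ≤ r) (hx : 0 < x) :
    (drawLaw m u).real {d | ¬ supTest z H d - ∫ d', supTest z H d' ∂(drawLaw m u) ≤
      (4 * (m : ℝ) / ((m + u : ℕ) : ℝ)) * (2 * √(3 * r * x / u) +
        (⨅ α : Set.Ioi (0 : ℝ), (testComplexity z (squareClass H) / (α : ℝ) +
          (α : ℝ) * x / u)) + 2 * H₀ ^ 2 * x / u)} ≤ Real.exp (-x) := by
  classical
  have : Nonempty H := hH.to_subtype
  set G : Finset (Fin (m + u)) → ℝ := fun T => ⨆ j : H, (1 / (u : ℝ)) * ∑ a ∈ T, j.1 (z a) with hG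
  have hsup : ∀ d : Draws m u, supTest z H d = G (testIdx d) := fun d => rfl
  have hR : testComplexity z (squareClass H) = 𝔼 T ∈ univ.powersetCard u, ⨆ j : H,
      ((1 / (u : ℝ)) * ∑ a ∈ T, j.1 (z a) ^ 2 -
        (1 / ((u + m : ℕ) : ℝ)) * ∑ a : Fin (m + u), j.1 (z a) ^ 2) := by
    rw [testComplexity, integral_drawLaw, ← expect_testIdx, add_comm u m]
    exact expect_congr rfl fun d _ =>
      iSup_squareClass H fun f => testAvg z d f - fullAvg z f
  have hc : 2 ≤ 4 * (m : ℝ) / ((m + u : ℕ) : ℝ) := by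
    have : (u : ℝ) ≤ m := by exact_mod_cast hum
    rw [le_div_iff₀ (by positivity)]
    push_cast
    linarith
  have key := card_iSup_deviation_le (A := univ) (h := fun (j : H) a => j.1 (z a)) hu hm hum
    (by simp [add_comm]) hH₀ (fun j a _ => hbound j.1 j.2 a)
    (fun j => by rw [add_comm u m]; exact hr j.1 j.2) hx hc hG hR
  rw [← expect_ite_eq_card_div, ← expect_testIdx, ← expect_testIdx] at key
  rw [drawLaw_real_setOf, integral_drawLaw]
  simp only [hsup, not_le]
  exact key

theorem supTest_deviation_of_lt (hm : 0 < m) (hu : 0 < u) (hmu : m < u) (hH : H.Nonempty)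
    (hH₀ : 2 * √2 ≤ H₀) (hzero : ∀ h ∈ H, fullAvg z h = 0)
    (hbound : ∀ h ∈ H, ∀ i, |h (z i)| ≤ H₀)
    (hr : ∀ h ∈ H, fullSqAvg z h ≤ r) (hx : 0 < x) :
    (drawLaw m u).real {d | ¬ supTest z H d - ∫ d', supTest z H d' ∂(drawLaw m u) ≤
      (4 * (m : ℝ) / ((m + u : ℕ) : ℝ)) * (2 * √(3 * r * x / m) +
        (⨅ α : Set.Ioi (0 : ℝ), (trainComplexity z (squareClass H) / (α : ℝ) +
          (α : ℝ) * x / m)) + 2 * H₀ ^ 2 * x / m)} ≤ Real.exp (-x) := by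
  classical
  have : Nonempty H := hH.to_subtype
  have hm' : (0 : ℝ) < m := by positivity
  have hu' : (0 : ℝ) < u := by positivity
  set G : Finset (Fin (m + u)) → ℝ :=
    fun T => ⨆ j : H, (1 / (m : ℝ)) * ∑ a ∈ T, -j.1 (z a) with hG
  have hsup : ∀ d : Draws m u, supTest z H d = (m / u : ℝ) * G (trainIdx d) := by
    intro d
    rw [hG, Real.mul_iSup_of_nonneg (by positivity)]
    exact iSup_congr fun j => testAvg_eq_trainAvg_neg hm d (hzero j.1 j.2)
  have hR : trainComplexity z (squareClass H) = 𝔼 T ∈ univ.powersetCard m, ⨆ j : H,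
      ((1 / (m : ℝ)) * ∑ a ∈ T, (-j.1 (z a)) ^ 2 -
        (1 / ((m + u : ℕ) : ℝ)) * ∑ a : Fin (m + u), (-j.1 (z a)) ^ 2) := by
    rw [trainComplexity, integral_drawLaw, ← expect_trainIdx]
    simp only [neg_sq]
    exact expect_congr rfl fun d _ =>
      iSup_squareClass H fun f => trainAvg z d f - fullAvg z f
  -- The constant for the training average; the factor `m / u` turns it into `4 * m / n`.
  have hc : 2 ≤ 4 * (u : ℝ) / ((m + u : ℕ) : ℝ) := by
    have : (m : ℝ) ≤ u := by exact_mod_cast hmu.le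
    rw [le_div_iff₀ (by positivity)]
    push_cast
    linarith
  have key := card_iSup_deviation_le (A := univ) (h := fun (j : H) a => -j.1 (z a)) hm hu hmu.le
    (by simp) hH₀ (fun j a _ => by rw [abs_neg]; exact hbound j.1 j.2 a)
    (fun j => by simp only [neg_sq]; exact hr j.1 j.2) hx hc hG hR
  rw [← expect_ite_eq_card_div, ← expect_trainIdx, ← expect_trainIdx] at key
  rw [drawLaw_real_setOf, integral_drawLaw]
  simp only [hsup, not_le, ← mul_expect, ← mul_sub]
  refine le_of_eq_of_le (expect_congr rfl fun d _ => if_congr ?_ rfl rfl) key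
  generalize 2 * √(3 * r * x / m) + (⨅ α : Set.Ioi (0 : ℝ),
    (trainComplexity z (squareClass H) / (α : ℝ) + (α : ℝ) * x / m)) + 2 * H₀ ^ 2 * x / m = W
  have hW : 4 * (m : ℝ) / ((m + u : ℕ) : ℝ) * W =
      (m / u : ℝ) * (4 * (u : ℝ) / ((m + u : ℕ) : ℝ) * W) := by
    field_simp
  rw [hW]
  exact mul_lt_mul_iff_right₀ (by positivity)

end Deviation

end Transductive

end

theorem mainTheorem5 {𝒳 𝒴 : Type*} (m u : ℕ) (hm : 0 < m) (hu : 0 < u)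
    (z : Fin (m + u) → 𝒳 × 𝒴) (H : Set (𝒳 × 𝒴 → ℝ)) (hH : H.Nonempty)
    (H₀ : ℝ) (hH₀ : 2 * √2 ≤ H₀)
    (hzero : ∀ h ∈ H, Transductive.fullAvg z h = 0)
    (hbound : ∀ h ∈ H, ∀ i, |h (z i)| ≤ H₀)
    (r : ℝ) (hr : ∀ h ∈ H, Transductive.fullSqAvg z h ≤ r)
    (x : ℝ) (hx : 0 < x) :
    1 - Real.exp (-x) ≤
      (Transductive.drawLaw m u).real
        {d | Transductive.supTest z H d
              - ∫ d', Transductive.supTest z H d' ∂(Transductive.drawLaw m u) ≤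
            (4 * (m : ℝ) / ((m + u : ℕ) : ℝ)) *
              (2 * √(3 * r * x / ((min u m : ℕ) : ℝ))
                + (⨅ α : Set.Ioi (0 : ℝ),
                    (Transductive.minComplexity z (Transductive.squareClass H) / (α : ℝ)
                      + (α : ℝ) * x / ((min u m : ℕ) : ℝ)))
                + 2 * H₀ ^ 2 * x / ((min u m : ℕ) : ℝ))} := by
  refine Transductive.one_sub_le_drawLaw_real ?_
  rcases le_or_gt u m with hum | hmu
  · rw [min_eq_left hum, Transductive.minComplexity, if_pos hum]
    exact Transductive.supTest_deviation_of_le hm hu hum hH hH₀ hbound hr hx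
  · rw [min_eq_right hmu.le, Transductive.minComplexity, if_neg hmu.not_ge]
    exact Transductive.supTest_deviation_of_lt hm hu hmu hH hH₀ hzero hbound hr hx
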